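/- Let $D$ be a compact complex manifold of complex dimension $m\ge 1$, and let $\pi:E\to D$ be an ample holomorphic line bundle with a smooth Hermitian metric $h$ of positive curvature, i.e. such that $\omega_D=-\sqrt{-1}\,\partial\overline\partial\log|\sigma|_h^2$ ($\sigma$ a local nonvanishing holomorphic section) is a Kähler form on $D$. Let $E'\subset E$ be the complement of the zero section, with local holomorphic coordinates $(w^1,\dots,w^m,z)$ given by coordinates $w$ on $D$ and a linear fibre coordinate $z$. Let $S$ be the canonical section of $\pi^*E$, so that $|S|^2_{\pi^*h}(e)=|e|_h^2$, and put $\omega_0=\sqrt{-1}\,\partial\overline\partial\,|S|^{-2}_{\pi^*h}$ on $E'$, and $V=z\partial_z+\overline z\partial_{\overline z}$, the generator of $e\mapsto e^{t}e$. For a $(1,1)$-form $\omega=\sqrt{-1}\sum g_{i\bar j}\,d\zeta^i\wedge d\overline\zeta^j$ write $\mathrm{Ric}(\omega)=-\sqrt{-1}\,\partial\overline\partial\log\det(g_{i\bar j})$; for a formal series $\omega=\sum_{k\ge-2}\omega_{(k)}$ with $\mathcal L_V\omega_{(k)}=k\,\omega_{(k)}$ and $\omega_{(-2)}=\omega_0$,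 $\mathrm{Ric}(\omega)$ is computed by expanding $\log\det$ as a formal series graded by the weight $k$. Then there are smooth real functions $u_{(k)}$ on $E'$, for integers $k>0$, with $\mathcal L_Vu_{(k)}=k\,u_{(k)}$, such that $$\omega=\omega_0-\mathrm{Ric}(\omega_0)+\sqrt{-1}\,\partial\overline\partial\sum_{k>0}u_{(k)}$$ formally satisfies the expanding soliton equation $\mathrm{Ric}(\omega)+\tfrac12\mathcal L_V\omega=-\omega$, that is, satisfies it in each weight. The $u_{(k)}$ are unique among all smooth real functions on $E'$ with these properties. Each $u_{(k)}$ restricts to every fibre of $E'\to D$ as a homogeneous polynomial of degree $k$ in $z,\overline z$. Moreover $\omega$ is a gradient soliton: there is a formal series $F=\sum_{k\ge-2}F_{(k)}$ of smooth real functions on $E'$ with $\mathcal L_VF_{(k)}=k\,F_{(k)}$ and $i_{V^{(1,0)}}\omega=\sqrt{-1}\,\overline\partial F$ in each weight, where $V^{(1,0)}=z\partial_z$. -/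

import Mathlib

open scoped Manifold ContDiff ComplexOrder Bundle

noncomputable section

namespace ExpandingSoliton

section Wirtinger

variable {X : Type*} [NormedAddCommGroup X] [NormedSpace ℂ X]

/-- The Wirtinger derivative `∂f/∂ζ = ½ (∂f/∂x - √-1 ∂f/∂y)` in the complex direction `v`. -/
def wirt (f : X → ℂ) (v x : X) : ℂ :=
  (fderiv ℝ f x v - Complex.I * fderiv ℝ f x (Complex.I • v)) / 2

/-- The conjugate Wirtinger derivative `∂f/∂ζ̄ = ½ (∂f/∂x + √-1 ∂f/∂y)` in the complex
direction `v`. -/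
def wirtBar (f : X → ℂ) (v x : X) : ℂ :=
  (fderiv ℝ f x v + Complex.I * fderiv ℝ f x (Complex.I • v)) / 2

/-- `(1,1)`-forms are written in complex coordinates `ζ` as `√-1 ∑ g i j dζⁱ ∧ dζ̄ʲ` and are
represented by the matrix-valued function `g`. With `b` the coordinate vectors, `ddbar b f` is the
matrix `∂²f/∂ζⁱ∂ζ̄ʲ` that represents the form `√-1 ∂∂̄f`. -/
def ddbar {ι : Type*} (b : ι → X) (f : X → ℂ) (x : X) : Matrix ι ι ℂ :=
  Matrix.of fun i j => wirt (fun y => wirtBar f (b j) y) (b i) x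

/-- The Ricci form `-√-1 ∂∂̄ log det g` of the `(1,1)`-form with matrix `g`. -/
def ricci {ι : Type*} [Fintype ι] [DecidableEq ι] (b : ι → X) (g : X → Matrix ι ι ℂ) (x : X) :
    Matrix ι ι ℂ :=
  -ddbar b (fun y => Complex.log (g y).det) x

/-- A formal series `∑_{k ≥ -2} Ω_(k)` of `(1,1)`-forms, `Ω_(k)` being the part of weight `k`,
is given as a family `Ω : ℤ → _`. This is the determinant at `y` of its coefficient matrix,
divided by the leading weight: `det (∑_{l ≥ 0} t^l Ω_(l - 2))`, the power of the formal variable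
`t` counting the weight. -/
def formalDet {ι : Type*} [Fintype ι] [DecidableEq ι] (Ω : ℤ → X → Matrix ι ι ℂ) (y : X) :
    PowerSeries ℂ :=
  (Matrix.of fun i j => PowerSeries.mk fun l : ℕ => Ω ((l : ℤ) - 2) y i j).det

/-- The formal expansion of `log det Ω`, namely
`log det Ω_(-2) + log (det Ω / det Ω_(-2))`, where the second logarithm is that of a power series
with constant coefficient one. (The omitted overall factor `t^(-2n)` of the determinant only adds
to `log det` a term that is constant on the manifold, which `∂∂̄` kills.) -/
def formalLogDet {ι : Type*} [Fintype ι] [DecidableEq ι] (Ω : ℤ → X → Matrix ι ι ℂ) (y : X) :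
    PowerSeries ℂ :=
  PowerSeries.C (Complex.log (Ω (-2) y).det) +
    PowerSeries.logOf (PowerSeries.C ((Ω (-2) y).det)⁻¹ * formalDet Ω y)

/-- The part of weight `k` of the Ricci form `-√-1 ∂∂̄ log det Ω` of a formal series `Ω` of
`(1,1)`-forms with leading weight `-2`. -/
def formalRicci {ι : Type*} [Fintype ι] [DecidableEq ι] (b : ι → X) (Ω : ℤ → X → Matrix ι ι ℂ)
    (k : ℤ) (x : X) : Matrix ι ι ℂ :=
  if 0 ≤ k then -ddbar b (fun y => PowerSeries.coeff k.toNat (formalLogDet Ω y)) x else 0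

end Wirtinger

/-- The coordinate vectors on `ℂᵐ`. -/
def baseVec (m : ℕ) (a : Fin m) : EuclideanSpace ℂ (Fin m) := EuclideanSpace.single a 1

/-- The coordinate vectors on `ℂᵐ × ℂ`, with coordinates `(w, z)`; the index `Sum.inr ()` is that
of `z`. -/
def coordVec (m : ℕ) : Fin m ⊕ Unit → EuclideanSpace ℂ (Fin m) × ℂ
  | Sum.inl a => (baseVec m a, 0)
  | Sum.inr _ => (0, 1)

/-- The Lie derivative of the `(1,1)`-form with matrix `g` along `V = z ∂_z + z̄ ∂_z̄`, in
coordinates `(w, z)`: the derivative at `t = 0` of the pullback of the form under the flow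
`(w, z) ↦ (w, eᵗ z)` of `V`. -/
def lieForm {m : ℕ}
    (g : EuclideanSpace ℂ (Fin m) × ℂ → Matrix (Fin m ⊕ Unit) (Fin m ⊕ Unit) ℂ)
    (y : EuclideanSpace ℂ (Fin m) × ℂ) : Matrix (Fin m ⊕ Unit) (Fin m ⊕ Unit) ℂ :=
  Matrix.of fun i j => deriv (fun t : ℝ =>
    (Sum.elim (fun _ => 1) (fun _ => (Real.exp t : ℂ)) i : ℂ) *
      g (y.1, (Real.exp t : ℂ) * y.2) i j *
      (Sum.elim (fun _ => 1) (fun _ => (Real.exp t : ℂ)) j : ℂ)) 0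

section Bundle

variable {m : ℕ} {D : Type*} [TopologicalSpace D] [ChartedSpace (EuclideanSpace ℂ (Fin m)) D]
  {E : D → Type*} [∀ x, AddCommGroup (E x)] [∀ x, Module ℂ (E x)]
  [TopologicalSpace (Bundle.TotalSpace ℂ E)] [∀ x, TopologicalSpace (E x)]
  [FiberBundle ℂ E]

variable (E) in
/-- The complement of the zero section. -/
def puncturedTotal : Set (Bundle.TotalSpace ℂ E) := {p | p.2 ≠ 0}

variable (E) in
/-- The domain in `ℂᵐ` of the local coordinates `w` around `x₀` on which `E` is trivialized. -/
def baseDomain (x₀ : D) : Set (EuclideanSpace ℂ (Fin m)) :=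
  {w | w ∈ (chartAt (EuclideanSpace ℂ (Fin m)) x₀).target ∧
    (chartAt (EuclideanSpace ℂ (Fin m)) x₀).symm w ∈ (trivializationAt ℂ E x₀).baseSet}

variable (E) in
/-- The domain of the local coordinates `(w, z)` on the complement of the zero section. -/
def coordDomain (x₀ : D) : Set (EuclideanSpace ℂ (Fin m) × ℂ) :=
  {y | y.1 ∈ baseDomain E x₀ ∧ y.2 ≠ 0}

variable (E) in
/-- The local holomorphic parametrization of the total space of `E` by `(w, z)`, from the chart of
the base and the trivialization of `E` around `x₀`. -/
def param (x₀ : D) (y : EuclideanSpace ℂ (Fin m) × ℂ) : Bundle.TotalSpace ℂ E :=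
  (trivializationAt ℂ E x₀).toOpenPartialHomeomorph.symm
    ((chartAt (EuclideanSpace ℂ (Fin m)) x₀).symm y.1, y.2)

variable (E) in
/-- A smooth Hermitian metric on the line bundle `E`: a positive definite Hermitian form on each
fibre such that `|σ|²` is smooth for each of the local holomorphic frames `σ = param E x₀ (·, 1)`. -/
structure HermitianMetric where
  inner : ∀ x, E x →ₗ⋆[ℂ] E x →ₗ[ℂ] ℂ
  conj_symm : ∀ x v w, starRingEnd ℂ (inner x v w) = inner x w v
  pos : ∀ x v, v ≠ 0 → 0 < (inner x v v).re
  smooth : ∀ x₀ : D, ContDiffOn ℝ ∞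
    (fun w : EuclideanSpace ℂ (Fin m) =>
      (inner (param E x₀ (w, 1)).1 (param E x₀ (w, 1)).2 (param E x₀ (w, 1)).2).re)
    (baseDomain E x₀)

/-- The function `e ↦ |e|²_h` on the total space; it is the squared norm `|S|²` of the canonical
section `S` of the pullback of `E` to its own total space. -/
def HermitianMetric.normSq (h : HermitianMetric (m := m) E) (p : Bundle.TotalSpace ℂ E) : ℝ :=
  (h.inner p.1 p.2 p.2).re

/-- The coordinate matrix of `√-1` times the curvature, `ω_D = -√-1 ∂∂̄ log |σ|²_h`, where `σ` is
the local holomorphic frame of `E` around `x₀`. -/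
def HermitianMetric.curvature (h : HermitianMetric (m := m) E) (x₀ : D)
    (w : EuclideanSpace ℂ (Fin m)) : Matrix (Fin m) (Fin m) ℂ :=
  -ddbar (baseVec m) (fun w' => (Real.log (h.normSq (param E x₀ (w', 1))) : ℂ)) w

/-- The curvature form `ω_D` of `h` is a Kähler form on the base. -/
def HermitianMetric.IsPositive (h : HermitianMetric (m := m) E) : Prop :=
  ∀ x₀ : D, ∀ w ∈ baseDomain E x₀, (h.curvature x₀ w).PosDef

/-- The coordinate matrix of `ω₀ = √-1 ∂∂̄ |S|⁻²`. -/
def HermitianMetric.omegaZero (h : HermitianMetric (m := m) E) (x₀ : D)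
    (y : EuclideanSpace ℂ (Fin m) × ℂ) : Matrix (Fin m ⊕ Unit) (Fin m ⊕ Unit) ℂ :=
  ddbar (coordVec m) (fun y' => ((h.normSq (param E x₀ y'))⁻¹ : ℂ)) y

variable (m) in
/-- A real function on the total space is smooth on the complement of the zero section. -/
def SmoothOff (f : Bundle.TotalSpace ℂ E → ℝ) : Prop :=
  ∀ x₀ : D, ContDiffOn ℝ ∞
    (fun y : EuclideanSpace ℂ (Fin m) × ℂ => f (param E x₀ y)) (coordDomain E x₀)

/-- `L_V f` for the vector field `V = z ∂_z + z̄ ∂_z̄`, whose flow is scalar multiplication by `eᵗ`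
on the fibres. -/
def lieFun (f : Bundle.TotalSpace ℂ E → ℝ) (p : Bundle.TotalSpace ℂ E) : ℝ :=
  deriv (fun t : ℝ => f ⟨p.1, (Real.exp t : ℂ) • p.2⟩) 0

variable (m) in
/-- `f` is smooth on the complement of the zero section and satisfies `L_V f = k f` there. -/
def HasWeight (k : ℤ) (f : Bundle.TotalSpace ℂ E → ℝ) : Prop :=
  SmoothOff m f ∧ ∀ p ∈ puncturedTotal E, lieFun f p = k * f p

/-- The parts of each weight of the formal series
`ω = ω₀ - Ric(ω₀) + √-1 ∂∂̄ ∑_{k > 0} u_(k)`, in the coordinates around `x₀`: weight `-2` is `ω₀`,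
weight `0` is `-Ric(ω₀)` and weight `k > 0` is `√-1 ∂∂̄ u_(k)`. -/
def HermitianMetric.formalForm (h : HermitianMetric (m := m) E)
    (u : ℕ → Bundle.TotalSpace ℂ E → ℝ) (x₀ : D) (k : ℤ)
    (y : EuclideanSpace ℂ (Fin m) × ℂ) : Matrix (Fin m ⊕ Unit) (Fin m ⊕ Unit) ℂ :=
  if k = -2 then h.omegaZero x₀ y
  else if k = 0 then -ricci (coordVec m) (h.omegaZero x₀) y
  else if 0 < k then ddbar (coordVec m) (fun y' => (u k.toNat (param E x₀ y') : ℂ)) y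
  else 0

/-- `u_(k)`, `k > 0`, is a formal expansion with `L_V u_(k) = k u_(k)` such that
`ω = ω₀ - Ric(ω₀) + √-1 ∂∂̄ ∑_{k > 0} u_(k)` formally satisfies the expanding soliton equation
`Ric(ω) + ½ L_V ω = -ω`, that is, in each weight `k`. -/
structure HermitianMetric.IsFormalSoliton (h : HermitianMetric (m := m) E)
    (u : ℕ → Bundle.TotalSpace ℂ E → ℝ) : Prop where
  weight : ∀ k : ℕ, 0 < k → HasWeight m k (u k)
  soliton : ∀ x₀ : D, ∀ k : ℤ, ∀ y ∈ coordDomain E x₀,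
    formalRicci (coordVec m) (h.formalForm u x₀) k y +
      (1 / 2 : ℂ) • lieForm (h.formalForm u x₀ k) y = -h.formalForm u x₀ k y

/-- The formal series `ω` is gradient: there is a real formal series `F = ∑ F_(k)` with
`i_{V^{(1,0)}} ω = √-1 ∂̄F` in each weight, where `V^{(1,0)} = z ∂_z`. For
`ω_(k) = √-1 ∑ g i j dζⁱ ∧ dζ̄ʲ` this says `z g_{z j} = ∂F_(k)/∂ζ̄ʲ`. -/
def HermitianMetric.IsGradient (h : HermitianMetric (m := m) E)
    (u : ℕ → Bundle.TotalSpace ℂ E → ℝ) : Prop :=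
  ∃ F : ℤ → Bundle.TotalSpace ℂ E → ℝ, (∀ k, HasWeight m k (F k)) ∧
    (∀ k < -2, ∀ p ∈ puncturedTotal E, F k p = 0) ∧
    ∀ x₀ : D, ∀ k : ℤ, ∀ y ∈ coordDomain E x₀, ∀ j,
      y.2 * h.formalForm u x₀ k y (Sum.inr ()) j =
        wirtBar (fun y' => (F k (param E x₀ y') : ℂ)) (coordVec m j) y

/-- The restriction of `f` to every fibre of `E`, minus zero, is a homogeneous polynomial of
degree `k` in the fibre coordinate `z` and its conjugate. -/
def IsFibrePolynomial (k : ℕ) (f : Bundle.TotalSpace ℂ E → ℝ) : Prop :=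
  ∀ p ∈ puncturedTotal E, ∃ c : ℕ → ℂ, ∀ z : ℂ, z ≠ 0 →
    (f ⟨p.1, z • p.2⟩ : ℂ) =
      ∑ a ∈ Finset.range (k + 1), c a * z ^ a * (starRingEnd ℂ z) ^ (k - a)

end Bundle

end ExpandingSoliton

end

/-! In weights -2 and 0 the soliton equation holds automatically: `½ L_V` acts on ω₀ as -1 and kills
weight 0, where the form was chosen to be -Ric(ω₀). In weight k > 0 let c_k be the coefficient of
t^k in log(det ω / det ω₀). Since L_V acts as k, the equation reads (k + 2)/2 · ∂∂̄u_k = ∂∂̄c_k. The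
coefficient of t^k sees only the forms of weight at most k - 2 (`IsAdmissible.logDetCoeff_congr`),
so u_k = 2/(k + 2) · c_k is a recursion that solves the equation.

The recursion makes sense globally because det ω / det ω₀ is a ratio: a holomorphic change of
coordinates multiplies both determinants by |det J|², which cancels (`coeff_logDetRatio_scale`,
`logDetCoeff_comp`). The same computation for the dilation of the fibres by a complex number c gives
u_k(c·p) = |c|^k u_k(p). Replacing t by -t shows that u_k = 0 for odd k, hence u_k is a multiple of
(z z̄)^(k/2) on each fibre. The division by det ω₀ is legitimate because ω₀ is positive
(`HermitianMetric.IsPositive.posDef`).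

The soliton is gradient by Euler's identity: z∂_z f = (k/2) f for f homogeneous of weight k and
rotation invariant, so the contraction of √-1 ∂∂̄f with z∂_z has potential (k/2) f. In weight 0 the
potential of the form is log det ω₀, on which z∂_z is constant, so F_(0) = 0 works.

For uniqueness, induction on k reduces to a pluriharmonic f of weight k > 0. The quotient f/|S|^k is
invariant under positive dilations and D is compact, so it has a maximum M. If M > 0, then M|S|^k -
f has a local minimum, although its Levi form is negative on a vector killed by ∂ log|S|², by
positivity of ω_D (`HermitianMetric.IsPositive.nonpos_of_levi_eq_zero`). The same for -f gives f =
0. -/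

noncomputable section

namespace ExpandingSoliton

set_option linter.unusedSectionVars false

/-! ### Calculus of Wirtinger derivatives and the Levi form. -/

section Levi

variable {X : Type*} [NormedAddCommGroup X] [NormedSpace ℂ X]
  {Y : Type*} [NormedAddCommGroup Y] [NormedSpace ℂ Y]

/-- The Levi form `∂_v ∂̄_w f`; it is linear in `v` and antilinear in `w`. -/
def levi (f : X → ℂ) (v w x : X) : ℂ :=
  wirt (fun y => wirtBar f w y) v x

theorem ddbar_apply {ι : Type*} (b : ι → X) (f : X → ℂ) (x : X) (i j : ι) :
    ddbar b f x i j = levi f (b i) (b j) x := rfl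

theorem wirt_congr {f g : X → ℂ} {x : X} (h : f =ᶠ[nhds x] g) (v : X) :
    wirt f v x = wirt g v x := by
  simp only [wirt, h.fderiv_eq]

theorem wirtBar_congr {f g : X → ℂ} {x : X} (h : f =ᶠ[nhds x] g) (v : X) :
    wirtBar f v x = wirtBar g v x := by
  simp only [wirtBar, h.fderiv_eq]

theorem levi_congr {f g : X → ℂ} {x : X} (h : f =ᶠ[nhds x] g) (v w : X) :
    levi f v w x = levi g v w x :=
  wirt_congr (h.eventuallyEq_nhds.mono fun _ hy => wirtBar_congr hy w) v

theorem ddbar_congr {ι : Type*} (b : ι → X) {f g : X → ℂ} {x : X} (h : f =ᶠ[nhds x] g) :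
    ddbar b f x = ddbar b g x := by
  ext i j
  exact levi_congr h _ _

theorem differentiableAt_fderiv {f : X → ℂ} {x : X} (hf : ContDiffAt ℝ 2 f x) :
    DifferentiableAt ℝ (fderiv ℝ f) x :=
  (hf.fderiv_right (m := 1) (by norm_num)).differentiableAt one_ne_zero

theorem differentiableAt_of_two {f : X → ℂ} {x : X} (hf : ContDiffAt ℝ 2 f x) :
    DifferentiableAt ℝ f x :=
  hf.differentiableAt two_ne_zero

theorem eventually_differentiableAt {f : X → ℂ} {x : X} (hf : ContDiffAt ℝ 2 f x) :
    ∀ᶠ y in nhds x, DifferentiableAt ℝ f y :=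
  (hf.eventually (by simp)).mono fun _ hy => differentiableAt_of_two hy

theorem hasFDerivAt_fderiv_apply {f : X → ℂ} {x : X} (hf : ContDiffAt ℝ 2 f x) (w : X) :
    HasFDerivAt (fun y => fderiv ℝ f y w) ((fderiv ℝ (fderiv ℝ f) x).flip w) x := by
  have := (differentiableAt_fderiv hf).hasFDerivAt.clm_apply (hasFDerivAt_const w x)
  simpa using this

theorem hasFDerivAt_wirtBar {f : X → ℂ} {x : X} (hf : ContDiffAt ℝ 2 f x) (w : X) :
    HasFDerivAt (fun y => wirtBar f w y)
      ((2⁻¹ : ℂ) • ((fderiv ℝ (fderiv ℝ f) x).flip w +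
        Complex.I • (fderiv ℝ (fderiv ℝ f) x).flip (Complex.I • w))) x := by
  have h1 := hasFDerivAt_fderiv_apply hf w
  have h2 := hasFDerivAt_fderiv_apply hf (Complex.I • w)
  have := (h1.add (h2.const_smul Complex.I)).const_smul (2⁻¹ : ℂ)
  refine this.congr_of_eventuallyEq (Filter.Eventually.of_forall fun y => ?_)
  simp [wirtBar]
  ring

theorem hasFDerivAt_wirt {f : X → ℂ} {x : X} (hf : ContDiffAt ℝ 2 f x) (w : X) :
    HasFDerivAt (fun y => wirt f w y)
      ((2⁻¹ : ℂ) • ((fderiv ℝ (fderiv ℝ f) x).flip w -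
        Complex.I • (fderiv ℝ (fderiv ℝ f) x).flip (Complex.I • w))) x := by
  have h1 := hasFDerivAt_fderiv_apply hf w
  have h2 := hasFDerivAt_fderiv_apply hf (Complex.I • w)
  have := (h1.sub (h2.const_smul Complex.I)).const_smul (2⁻¹ : ℂ)
  refine this.congr_of_eventuallyEq (Filter.Eventually.of_forall fun y => ?_)
  simp [wirt]
  ring

theorem levi_eq {f : X → ℂ} {x : X} (hf : ContDiffAt ℝ 2 f x) (v w : X) :
    levi f v w x = (fderiv ℝ (fderiv ℝ f) x v w
      + fderiv ℝ (fderiv ℝ f) x (Complex.I • v) (Complex.I • w)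
      + Complex.I * (fderiv ℝ (fderiv ℝ f) x v (Complex.I • w)
        - fderiv ℝ (fderiv ℝ f) x (Complex.I • v) w)) / 4 := by
  rw [levi, wirt, (hasFDerivAt_wirtBar hf w).fderiv]
  simp
  ring_nf
  simp
  ring

theorem fderiv_fderiv_symm {f : X → ℂ} {x : X} (hf : ContDiffAt ℝ 2 f x) (v w : X) :
    fderiv ℝ (fderiv ℝ f) x v w = fderiv ℝ (fderiv ℝ f) x w v :=
  (hf.isSymmSndFDerivAt (by simp)).eq v w

theorem levi_eq_wirtBar_wirt {f : X → ℂ} {x : X} (hf : ContDiffAt ℝ 2 f x) (v w : X) :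
    levi f v w x = wirtBar (fun y => wirt f v y) w x := by
  rw [levi_eq hf, wirtBar, (hasFDerivAt_wirt hf v).fderiv]
  simp only [smul_apply, sub_apply,
    ContinuousLinearMap.flip_apply, smul_eq_mul]
  rw [fderiv_fderiv_symm hf w v, fderiv_fderiv_symm hf (Complex.I • w) v,
    fderiv_fderiv_symm hf w (Complex.I • v), fderiv_fderiv_symm hf (Complex.I • w) (Complex.I • v)]
  ring_nf
  simp
  ring

theorem levi_of_fderiv_const {f : X → ℂ} (L : X →L[ℝ] ℂ) (hf : ∀ y, fderiv ℝ f y = L) (v w x : X) :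
    levi f v w x = 0 := by
  have : (fun y => wirtBar f w y) = fun _ => (L w + Complex.I * L (Complex.I • w)) / 2 := by
    funext y
    simp [wirtBar, hf]
  rw [levi, this]
  simp [wirt]

theorem levi_const (c : ℂ) (v w x : X) : levi (fun _ => c) v w x = 0 :=
  levi_of_fderiv_const 0 (by simp) v w x

theorem levi_clm (L : X →L[ℝ] ℂ) (v w x : X) : levi L v w x = 0 :=
  levi_of_fderiv_const L (fun _ => L.fderiv) v w x

theorem wirtBar_add {f g : X → ℂ} {x : X} (hf : DifferentiableAt ℝ f x)
    (hg : DifferentiableAt ℝ g x) (w : X) :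
    wirtBar (fun y => f y + g y) w x = wirtBar f w x + wirtBar g w x := by
  simp only [wirtBar, fderiv_fun_add hf hg, add_apply]
  ring

theorem wirt_add {f g : X → ℂ} {x : X} (hf : DifferentiableAt ℝ f x)
    (hg : DifferentiableAt ℝ g x) (w : X) :
    wirt (fun y => f y + g y) w x = wirt f w x + wirt g w x := by
  simp only [wirt, fderiv_fun_add hf hg, add_apply]
  ring

theorem wirtBar_mul {f g : X → ℂ} {x : X} (hf : DifferentiableAt ℝ f x)
    (hg : DifferentiableAt ℝ g x) (w : X) :
    wirtBar (fun y => f y * g y) w x = f x * wirtBar g w x + wirtBar f w x * g x := by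
  simp only [wirtBar, fderiv_fun_mul hf hg, add_apply,
    smul_apply, smul_eq_mul]
  ring

theorem wirt_mul {f g : X → ℂ} {x : X} (hf : DifferentiableAt ℝ f x)
    (hg : DifferentiableAt ℝ g x) (w : X) :
    wirt (fun y => f y * g y) w x = f x * wirt g w x + wirt f w x * g x := by
  simp only [wirt, fderiv_fun_mul hf hg, add_apply,
    smul_apply, smul_eq_mul]
  ring

theorem wirtBar_const (c : ℂ) (w x : X) : wirtBar (fun _ => c) w x = 0 := by
  simp [wirtBar]

theorem wirt_const (c : ℂ) (w x : X) : wirt (fun _ => c) w x = 0 := by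
  simp [wirt]

theorem wirtBar_const_mul (c : ℂ) (f : X → ℂ) (w x : X) :
    wirtBar (fun y => c * f y) w x = c * wirtBar f w x := by
  have : (fun y => c * f y) = c • f := rfl
  simp only [wirtBar, this, fderiv_const_smul_field, Pi.smul_apply, smul_apply, smul_eq_mul]
  ring

theorem wirt_const_mul (c : ℂ) (f : X → ℂ) (w x : X) :
    wirt (fun y => c * f y) w x = c * wirt f w x := by
  have : (fun y => c * f y) = c • f := rfl
  simp only [wirt, this, fderiv_const_smul_field, Pi.smul_apply, smul_apply, smul_eq_mul]
  ring

theorem levi_const_mul (c : ℂ) (f : X → ℂ) (v w x : X) :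
    levi (fun y => c * f y) v w x = c * levi f v w x := by
  simp only [levi, wirtBar_const_mul, wirt_const_mul]

theorem levi_add {f g : X → ℂ} {x : X} (hf : ContDiffAt ℝ 2 f x) (hg : ContDiffAt ℝ 2 g x)
    (v w : X) : levi (fun y => f y + g y) v w x = levi f v w x + levi g v w x := by
  have h : (fun y => wirtBar (fun y => f y + g y) w y) =ᶠ[nhds x]
      fun y => wirtBar f w y + wirtBar g w y := by
    filter_upwards [eventually_differentiableAt hf, eventually_differentiableAt hg] with y h1 h2
    exact wirtBar_add h1 h2 w
  rw [levi, wirt_congr h, wirt_add (hasFDerivAt_wirtBar hf w).differentiableAt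
    (hasFDerivAt_wirtBar hg w).differentiableAt]
  rfl

theorem levi_sub {f g : X → ℂ} {x : X} (hf : ContDiffAt ℝ 2 f x) (hg : ContDiffAt ℝ 2 g x)
    (v w : X) : levi (fun y => f y - g y) v w x = levi f v w x - levi g v w x := by
  have := levi_add hf (contDiffAt_const.mul hg : ContDiffAt ℝ 2 (fun y => (-1 : ℂ) * g y) x) v w
  rw [levi_const_mul] at this
  simpa [sub_eq_add_neg] using this

theorem wirt_exp {f : X → ℂ} {x : X} (hf : DifferentiableAt ℝ f x) (w : X) :
    wirt (fun y => Complex.exp (f y)) w x = Complex.exp (f x) * wirt f w x := by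
  simp only [wirt, hf.hasFDerivAt.cexp.fderiv, smul_apply, smul_eq_mul]
  ring

theorem wirtBar_exp {f : X → ℂ} {x : X} (hf : DifferentiableAt ℝ f x) (w : X) :
    wirtBar (fun y => Complex.exp (f y)) w x = Complex.exp (f x) * wirtBar f w x := by
  simp only [wirtBar, hf.hasFDerivAt.cexp.fderiv, smul_apply, smul_eq_mul]
  ring

theorem levi_exp {f : X → ℂ} {x : X} (hf : ContDiffAt ℝ 2 f x) (v w : X) :
    levi (fun y => Complex.exp (f y)) v w x =
      Complex.exp (f x) * (levi f v w x + wirt f v x * wirtBar f w x) := by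
  have h : (fun y => wirtBar (fun y => Complex.exp (f y)) w y) =ᶠ[nhds x]
      fun y => Complex.exp (f y) * wirtBar f w y := by
    filter_upwards [eventually_differentiableAt hf] with y h1
    exact wirtBar_exp h1 w
  have hd := differentiableAt_of_two hf
  rw [levi, wirt_congr h, wirt_mul hd.cexp (hasFDerivAt_wirtBar hf w).differentiableAt,
    wirt_exp hd, levi]
  ring

theorem wirt_add_left (f : X → ℂ) (v w x : X) : wirt f (v + w) x = wirt f v x + wirt f w x := by
  simp [wirt]
  ring

theorem wirt_smul_left (f : X → ℂ) (c : ℂ) (v x : X) : wirt f (c • v) x = c * wirt f v x := by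
  have h1 : c • v = c.re • v + c.im • (Complex.I • v) := by
    rw [← Complex.coe_smul, ← Complex.coe_smul, smul_smul, ← add_smul, Complex.re_add_im]
  have h2 : Complex.I • c • v = c.re • (Complex.I • v) - c.im • v := by
    rw [h1, smul_add, smul_comm _ c.re, smul_comm _ c.im, smul_smul Complex.I Complex.I]
    simp [sub_eq_add_neg]
  rw [wirt, wirt, h2, h1]
  simp only [map_add, map_sub, map_smul, Complex.real_smul]
  conv_rhs => rw [← Complex.re_add_im c]
  ring_nf
  simp
  ring

theorem wirtBar_add_left (f : X → ℂ) (v w x : X) :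
    wirtBar f (v + w) x = wirtBar f v x + wirtBar f w x := by
  simp [wirtBar]
  ring

theorem wirtBar_smul_left (f : X → ℂ) (c : ℂ) (v x : X) :
    wirtBar f (c • v) x = starRingEnd ℂ c * wirtBar f v x := by
  have h1 : c • v = c.re • v + c.im • (Complex.I • v) := by
    rw [← Complex.coe_smul, ← Complex.coe_smul, smul_smul, ← add_smul, Complex.re_add_im]
  have h2 : Complex.I • c • v = c.re • (Complex.I • v) - c.im • v := by
    rw [h1, smul_add, smul_comm _ c.re, smul_comm _ c.im, smul_smul Complex.I Complex.I]
    simp [sub_eq_add_neg]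
  rw [wirtBar, wirtBar, h2, h1]
  simp only [map_add, map_sub, map_smul, Complex.real_smul]
  rw [show starRingEnd ℂ c = c.re - c.im * Complex.I by apply Complex.ext <;> simp]
  ring_nf
  simp
  ring

theorem levi_add_left (f : X → ℂ) (v v' w x : X) :
    levi f (v + v') w x = levi f v w x + levi f v' w x :=
  wirt_add_left _ _ _ _

theorem levi_smul_left (f : X → ℂ) (c : ℂ) (v w x : X) :
    levi f (c • v) w x = c * levi f v w x :=
  wirt_smul_left _ _ _ _

theorem levi_add_right {f : X → ℂ} {x : X} (hf : ContDiffAt ℝ 2 f x) (v w w' : X) :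
    levi f v (w + w') x = levi f v w x + levi f v w' x := by
  rw [levi]
  simp_rw [wirtBar_add_left]
  exact wirt_add (hasFDerivAt_wirtBar hf w).differentiableAt
    (hasFDerivAt_wirtBar hf w').differentiableAt v

theorem levi_smul_right (f : X → ℂ) (c : ℂ) (v w x : X) :
    levi f v (c • w) x = starRingEnd ℂ c * levi f v w x := by
  rw [levi]
  simp_rw [wirtBar_smul_left]
  exact wirt_const_mul _ _ _ _

theorem levi_zero_left (f : X → ℂ) (w x : X) : levi f 0 w x = 0 := by
  simpa using levi_smul_left f 0 0 w x

theorem levi_zero_right (f : X → ℂ) (v x : X) : levi f v 0 x = 0 := by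
  simpa using levi_smul_right f 0 v 0 x

theorem levi_sum {f : X → ℂ} {x : X} (hf : ContDiffAt ℝ 2 f x) {ι : Type*} (s : Finset ι)
    (a c : ι → ℂ) (b : ι → X) :
    levi f (∑ i ∈ s, a i • b i) (∑ j ∈ s, c j • b j) x =
      ∑ i ∈ s, ∑ j ∈ s, a i * starRingEnd ℂ (c j) * levi f (b i) (b j) x := by
  have h1 : ∀ (t : Finset ι) (v : X), levi f (∑ i ∈ t, a i • b i) v x =
      ∑ i ∈ t, a i * levi f (b i) v x := by
    intro t v
    induction t using Finset.cons_induction with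
    | empty => simp [levi_zero_left]
    | cons i t hi ih => rw [Finset.sum_cons, Finset.sum_cons, levi_add_left, levi_smul_left, ih]
  have h2 : ∀ (t : Finset ι) (v : X), levi f v (∑ i ∈ t, c i • b i) x =
      ∑ i ∈ t, starRingEnd ℂ (c i) * levi f v (b i) x := by
    intro t v
    induction t using Finset.cons_induction with
    | empty => simp [levi_zero_right]
    | cons i t hi ih => rw [Finset.sum_cons, Finset.sum_cons, levi_add_right hf, levi_smul_right, ih]
  rw [h1]
  refine Finset.sum_congr rfl fun i _ => ?_
  rw [h2, Finset.mul_sum]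
  exact Finset.sum_congr rfl fun j _ => by ring

theorem wirt_comp {F : Y → ℂ} {T : X → Y} {x : X} (hF : DifferentiableAt ℝ F (T x))
    (hT : DifferentiableAt ℂ T x) (v : X) :
    wirt (fun y => F (T y)) v x = wirt F (fderiv ℂ T x v) (T x) := by
  have h := (hF.hasFDerivAt.comp x (hT.hasFDerivAt.restrictScalars ℝ)).fderiv
  simp only [Function.comp_def] at h
  simp [wirt, h]

/-- The second derivative of a holomorphic `T` is complex bilinear, so the terms in which it appears
cancel in the combination `levi_eq`; only first derivatives of `T` remain. -/
theorem levi_comp {F : Y → ℂ} {T : X → Y} {x : X} (hF : ContDiffAt ℝ 2 F (T x))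
    (hT : ContDiffAt ℂ 2 T x) (v w : X) :
    levi (fun y => F (T y)) v w x = levi F (fderiv ℂ T x v) (fderiv ℂ T x w) (T x) := by
  have hTR : ContDiffAt ℝ 2 T x := hT.restrict_scalars ℝ
  have hFT : ContDiffAt ℝ 2 (fun y => F (T y)) x := hF.comp x hTR
  have hTd : DifferentiableAt ℂ T x := hT.differentiableAt two_ne_zero
  have hT2 : DifferentiableAt ℂ (fderiv ℂ T) x :=
    (hT.fderiv_right (m := 1) (by norm_num)).differentiableAt one_ne_zero
  have key : ∀ v w : X, fderiv ℝ (fderiv ℝ (fun y => F (T y))) x v w =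
      fderiv ℝ (fderiv ℝ F) (T x) (fderiv ℂ T x v) (fderiv ℂ T x w) +
        fderiv ℝ F (T x) (fderiv ℂ (fderiv ℂ T) x v w) := by
    intro v w
    have e1 : fderiv ℝ (fderiv ℝ (fun y => F (T y))) x v w =
        fderiv ℝ (fun y => fderiv ℝ (fun y => F (T y)) y w) x v := by
      rw [(hasFDerivAt_fderiv_apply hFT w).fderiv]
      rfl
    have e2 : (fun y => fderiv ℝ (fun y => F (T y)) y w) =ᶠ[nhds x]
        fun y => fderiv ℝ F (T y) (fderiv ℂ T y w) := by
      filter_upwards [hT.continuousAt.eventually (eventually_differentiableAt hF),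
        (hT.eventually (by simp))] with y h1 h2
      have h := (h1.hasFDerivAt.comp y
        ((h2.differentiableAt two_ne_zero).hasFDerivAt.restrictScalars ℝ)).fderiv
      simp only [Function.comp_def] at h
      simp [h]
    have d1 : HasFDerivAt (fun y => fderiv ℝ F (T y)) _ x :=
      (differentiableAt_fderiv hF).hasFDerivAt.comp x (hTd.hasFDerivAt.restrictScalars ℝ)
    have d2 : HasFDerivAt (fun y => fderiv ℂ T y w) _ x :=
      (hT2.hasFDerivAt.clm_apply (hasFDerivAt_const w x)).restrictScalars ℝ
    rw [e1, e2.fderiv_eq, (d1.clm_apply d2).fderiv]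
    simp [add_comm]
  rw [levi_eq hFT, levi_eq hF, key, key, key, key]
  simp only [map_smul, smul_apply, smul_smul, Complex.I_mul_I]
  simp
  ring

theorem levi_star {f : X → ℂ} {x : X} (hf : ContDiffAt ℝ 2 f x) (v w : X) :
    levi (fun y => starRingEnd ℂ (f y)) v w x = starRingEnd ℂ (levi f w v x) := by
  have hc : ∀ y, fderiv ℝ (fun y => starRingEnd ℂ (f y)) y =
      (Complex.conjCLE : ℂ →L[ℝ] ℂ).comp (fderiv ℝ f y) := fun y =>
    Complex.conjCLE.comp_fderiv (f := f)
  have h1 : ∀ y v, wirtBar (fun y => starRingEnd ℂ (f y)) v y = starRingEnd ℂ (wirt f v y) := by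
    intro y v
    simp only [wirtBar, wirt, hc]
    simp [map_ofNat (starRingEnd ℂ) 2]
  have h2 : ∀ (g : X → ℂ) y v, wirt (fun y => starRingEnd ℂ (g y)) v y =
      starRingEnd ℂ (wirtBar g v y) := by
    intro g y v
    have hc : fderiv ℝ (fun y => starRingEnd ℂ (g y)) y =
      (Complex.conjCLE : ℂ →L[ℝ] ℂ).comp (fderiv ℝ g y) :=
      Complex.conjCLE.comp_fderiv (f := g)
    simp only [wirtBar, wirt, hc]
    simp [sub_eq_add_neg, map_ofNat (starRingEnd ℂ) 2]
  rw [levi]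
  simp_rw [h1]
  rw [h2, levi_eq_wirtBar_wirt hf]

theorem levi_ofReal_symm {f : X → ℝ} {x : X} (hf : ContDiffAt ℝ 2 (fun y => (f y : ℂ)) x)
    (v w : X) :
    starRingEnd ℂ (levi (fun y => (f y : ℂ)) v w x) = levi (fun y => (f y : ℂ)) w v x := by
  rw [← levi_star hf]
  simp

theorem wirtBar_ofReal (f : X → ℝ) (v x : X) :
    wirtBar (fun y => (f y : ℂ)) v x = starRingEnd ℂ (wirt (fun y => (f y : ℂ)) v x) := by
  have hc : fderiv ℝ (fun y => starRingEnd ℂ (f y : ℂ)) x =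
      (Complex.conjCLE : ℂ →L[ℝ] ℂ).comp (fderiv ℝ (fun y => (f y : ℂ)) x) :=
    Complex.conjCLE.comp_fderiv (f := fun y => (f y : ℂ))
  simp only [Complex.conj_ofReal] at hc
  rw [wirtBar, wirt]
  conv_lhs => rw [hc]
  simp [map_ofNat (starRingEnd ℂ) 2]

/-- Up to a constant, log|j| is the real part of the holomorphic function log(j / j(x)); dividing by
j(x) keeps the argument near 1, away from the branch cut. -/
theorem levi_log_norm {j : X → ℂ} {x : X} (hj : ContDiffAt ℂ 2 j x) (h0 : j x ≠ 0) (v w : X) :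
    levi (fun y => ((Real.log ‖j y‖ : ℝ) : ℂ)) v w x = 0 := by
  have hq : ContDiffAt ℂ 2 (fun y => j y / j x) x := hj.div_const _
  have hs : j x / j x ∈ Complex.slitPlane := by simp [div_self h0]
  have hL : ContDiffAt ℂ 2 (fun y => Complex.log (j y / j x)) x :=
    ContDiffAt.comp (g := Complex.log) x (Complex.contDiffAt_log hs) hq
  have hloc : (fun y => ((Real.log ‖j y‖ : ℝ) : ℂ)) =ᶠ[nhds x]
      fun y => ((Complex.log (j y / j x)).re : ℂ) + ((Real.log ‖j x‖ : ℝ) : ℂ) := by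
    filter_upwards [hj.continuousAt.eventually_ne h0] with y hy
    rw [Complex.log_re, norm_div, Real.log_div (by simpa using hy) (by simpa using h0)]
    push_cast
    ring
  let R : ℂ →L[ℝ] ℂ := Complex.ofRealCLM.comp Complex.reCLM
  have hR : levi (fun y => R (Complex.log (j y / j x))) v w x = 0 := by
    rw [levi_comp R.contDiff.contDiffAt hL, levi_clm]
  have hR2 : ContDiffAt ℝ 2 (fun y => R (Complex.log (j y / j x))) x :=
    R.contDiff.contDiffAt.comp x (hL.restrict_scalars ℝ)
  rw [levi_congr hloc]
  have := levi_add hR2 (contDiffAt_const (c := ((Real.log ‖j x‖ : ℝ) : ℂ))) v w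
  rw [hR, levi_const, add_zero] at this
  exact this

/-- Restrict to the line through `x` in direction `v`. A negative second derivative would make the
minimum a local maximum too, so the restriction would be locally constant and its second derivative
zero. -/
theorem fderiv_fderiv_nonneg_of_isLocalMin {f : X → ℝ} {x : X}
    (hf : ContDiffAt ℝ 2 (fun y => (f y : ℂ)) x) (hm : IsLocalMin f x) (v : X) :
    0 ≤ (fderiv ℝ (fderiv ℝ (fun y => (f y : ℂ))) x v v).re := by
  let γ : ℝ → X := fun t => x + t • v
  have hγ0 : γ 0 = x := by simp [γ]
  have hγ : ∀ t, HasDerivAt γ v t := fun t => by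
    simpa [γ] using ((hasDerivAt_id t).smul_const v).const_add x
  have hγc : Filter.Tendsto γ (nhds 0) (nhds x) := by
    simpa [hγ0] using (hγ 0).continuousAt.tendsto
  let g : ℝ → ℝ := fun t => f (γ t)
  have hg1 : ∀ᶠ t in nhds (0 : ℝ),
      HasDerivAt g (fderiv ℝ (fun y => (f y : ℂ)) (γ t) v).re t := by
    filter_upwards [hγc.eventually (eventually_differentiableAt hf)] with t ht
    exact Complex.reCLM.hasFDerivAt.comp_hasDerivAt t (ht.hasFDerivAt.comp_hasDerivAt t (hγ t))
  have hg1' : deriv g =ᶠ[nhds 0] fun t => (fderiv ℝ (fun y => (f y : ℂ)) (γ t) v).re :=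
    hg1.mono fun t ht => ht.deriv
  have hg2 : deriv (deriv g) 0 = (fderiv ℝ (fderiv ℝ (fun y => (f y : ℂ))) x v v).re := by
    rw [hg1'.deriv_eq]
    have h1 := hasFDerivAt_fderiv_apply hf v
    rw [← hγ0] at h1
    have := Complex.reCLM.hasFDerivAt.comp_hasDerivAt 0 (h1.comp_hasDerivAt 0 (hγ 0))
    refine this.deriv.trans ?_
    simp [hγ0]
  have hmin : IsLocalMin g 0 := by
    have : ∀ᶠ y in nhds x, f x ≤ f y := hm
    filter_upwards [hγc.eventually this] with t ht
    simpa [g, hγ0] using ht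
  rw [← hg2]
  by_contra! hneg
  have hmax : IsLocalMax g 0 :=
    isLocalMax_of_deriv_deriv_neg hneg hmin.deriv_eq_zero
      (hg1.self_of_nhds).continuousAt
  have hconst : g =ᶠ[nhds 0] fun _ => g 0 := by
    filter_upwards [hmin, hmax] with t h1 h2
    exact le_antisymm h2 h1
  have hd : deriv g =ᶠ[nhds 0] fun _ => (0 : ℝ) := by
    filter_upwards [hconst.eventuallyEq_nhds] with t ht
    rw [ht.deriv_eq, deriv_const]
  rw [hd.deriv_eq, deriv_const] at hneg
  exact lt_irrefl _ hneg

/-- On the diagonal the Levi form is a quarter of the sum of the real Hessian at `v` and at `iv`. -/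
theorem levi_nonneg_of_isLocalMin {f : X → ℝ} {x : X}
    (hf : ContDiffAt ℝ 2 (fun y => (f y : ℂ)) x) (hm : IsLocalMin f x) (v : X) :
    0 ≤ (levi (fun y => (f y : ℂ)) v v x).re := by
  have h1 := fderiv_fderiv_nonneg_of_isLocalMin hf hm v
  have h2 := fderiv_fderiv_nonneg_of_isLocalMin hf hm (Complex.I • v)
  rw [levi_eq hf, fderiv_fderiv_symm hf v (Complex.I • v), sub_self, mul_zero, add_zero]
  simp only [Complex.div_ofNat_re, Complex.add_re]
  positivity

theorem contDiffAt_fderiv_apply {f : X → ℂ} {x : X} (hf : ContDiffAt ℝ ∞ f x) (v : X) :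
    ContDiffAt ℝ ∞ (fun y => fderiv ℝ f y v) x :=
  (hf.fderiv_right (m := ∞) (by simp)).clm_apply contDiffAt_const

theorem contDiffAt_wirt {f : X → ℂ} {x : X} (hf : ContDiffAt ℝ ∞ f x) (v : X) :
    ContDiffAt ℝ ∞ (fun y => wirt f v y) x := by
  unfold wirt
  exact ((contDiffAt_fderiv_apply hf v).sub
    (contDiffAt_const.mul (contDiffAt_fderiv_apply hf _))).div_const 2

theorem contDiffAt_wirtBar {f : X → ℂ} {x : X} (hf : ContDiffAt ℝ ∞ f x) (v : X) :
    ContDiffAt ℝ ∞ (fun y => wirtBar f v y) x := by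
  unfold wirtBar
  exact ((contDiffAt_fderiv_apply hf v).add
    (contDiffAt_const.mul (contDiffAt_fderiv_apply hf _))).div_const 2

theorem contDiffAt_levi {f : X → ℂ} {x : X} (hf : ContDiffAt ℝ ∞ f x) (v w : X) :
    ContDiffAt ℝ ∞ (fun y => levi f v w y) x :=
  contDiffAt_wirt (contDiffAt_wirtBar hf w) v

end Levi

/-! ### The logarithm of the determinant of a matrix of power series. -/

section Series

open PowerSeries (coeff constantCoeff logOf rescale)

/-- The sum stops at `n` since `X` divides `f - 1`. Each coefficient of the logarithm is thus a
polynomial in those of `f`, from which naturality and smoothness follow. -/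
theorem coeff_logOf {f : PowerSeries ℂ} (hf : constantCoeff f = 1) (n : ℕ) :
    coeff n (logOf f) =
      ∑ d ∈ Finset.range (n + 1), coeff d (PowerSeries.log ℂ) * coeff n ((f - 1) ^ d) := by
  have h0 : constantCoeff (f - 1) = 0 := by simp [hf]
  rw [PowerSeries.logOf_eq,
    PowerSeries.coeff_subst' (PowerSeries.HasSubst.of_constantCoeff_zero' h0)]
  simp only [smul_eq_mul]
  refine finsum_eq_sum_of_support_subset _ fun d hd => ?_
  by_contra hlt
  apply hd
  have hXd : (PowerSeries.X : PowerSeries ℂ) ^ d ∣ (f - 1) ^ d :=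
    pow_dvd_pow_of_dvd (PowerSeries.X_dvd_iff.2 h0) d
  have : coeff n ((f - 1) ^ d) = 0 := PowerSeries.X_pow_dvd_iff.1 hXd n (by simpa using hlt)
  simp [this]

theorem logOf_rescale {f : PowerSeries ℂ} (hf : constantCoeff f = 1) (a : ℂ) :
    logOf (rescale a f) = rescale a (logOf f) := by
  have h1 : constantCoeff (rescale a f) = 1 := by
    rw [← PowerSeries.coeff_zero_eq_constantCoeff_apply, PowerSeries.coeff_rescale]
    simp [hf]
  ext n
  rw [coeff_logOf h1, PowerSeries.coeff_rescale, coeff_logOf hf, Finset.mul_sum]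
  refine Finset.sum_congr rfl fun d _ => ?_
  rw [show rescale a f - 1 = rescale a (f - 1) by simp, ← map_pow, PowerSeries.coeff_rescale]
  ring

theorem logOf_map {f : PowerSeries ℂ} (hf : constantCoeff f = 1) (φ : ℂ →+* ℂ) :
    logOf (PowerSeries.map φ f) = PowerSeries.map φ (logOf f) := by
  have h1 : constantCoeff (PowerSeries.map φ f) = 1 := by
    rw [← PowerSeries.coeff_zero_eq_constantCoeff_apply, PowerSeries.coeff_map]
    simp [hf]
  ext n
  rw [coeff_logOf h1, PowerSeries.coeff_map, coeff_logOf hf, map_sum]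
  refine Finset.sum_congr rfl fun d _ => ?_
  rw [show PowerSeries.map φ f - 1 = PowerSeries.map φ (f - 1) by
      rw [map_sub, map_one], ← map_pow,
    PowerSeries.coeff_map, map_mul, ← PowerSeries.coeff_map φ d, PowerSeries.map_log]

theorem coeff_logOf_congr {f g : PowerSeries ℂ} (hf : constantCoeff f = 1)
    (hg : constantCoeff g = 1) {n : ℕ} (h : (PowerSeries.X : PowerSeries ℂ) ^ (n + 1) ∣ f - g) :
    coeff n (logOf f) = coeff n (logOf g) := by
  rw [coeff_logOf hf, coeff_logOf hg]
  refine Finset.sum_congr rfl fun d _ => ?_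
  congr 1
  rw [← sub_eq_zero, ← map_sub]
  refine PowerSeries.X_pow_dvd_iff.1 (h.trans ?_) n (Nat.lt_succ_self n)
  have := sub_dvd_pow_sub_pow (f - 1) (g - 1) d
  rwa [sub_sub_sub_cancel_right] at this

variable {ι : Type*} [Fintype ι] [DecidableEq ι]

/-- The matrix of power series `∑ t^l A_l`. -/
def seriesMatrix (A : ℕ → Matrix ι ι ℂ) : Matrix ι ι (PowerSeries ℂ) :=
  Matrix.of fun i j => PowerSeries.mk fun l => A l i j

/-- The series `log (det (∑ t^l A_l) / det A_0)`. -/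
def logDetRatio (A : ℕ → Matrix ι ι ℂ) : PowerSeries ℂ :=
  logOf (PowerSeries.C (A 0).det⁻¹ * (seriesMatrix A).det)

theorem formalLogDet_eq {X : Type*} [NormedAddCommGroup X] [NormedSpace ℂ X]
    (Ω : ℤ → X → Matrix ι ι ℂ) (y : X) :
    formalLogDet Ω y = PowerSeries.C (Complex.log (Ω (-2) y).det) +
      logDetRatio fun l => Ω ((l : ℤ) - 2) y := rfl

theorem constantCoeff_det_seriesMatrix (A : ℕ → Matrix ι ι ℂ) :
    constantCoeff (seriesMatrix A).det = (A 0).det := by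
  rw [RingHom.map_det]
  congr 1

theorem constantCoeff_ratio {A : ℕ → Matrix ι ι ℂ} (hA : (A 0).det ≠ 0) :
    constantCoeff (PowerSeries.C (A 0).det⁻¹ * (seriesMatrix A).det) = 1 := by
  rw [map_mul, constantCoeff_det_seriesMatrix]
  simp [hA]

theorem constantCoeff_logDetRatio {A : ℕ → Matrix ι ι ℂ} (hA : (A 0).det ≠ 0) :
    constantCoeff (logDetRatio A) = 0 :=
  PowerSeries.constantCoeff_logOf (constantCoeff_ratio hA)

theorem coeff_logDetRatio_congr {A B : ℕ → Matrix ι ι ℂ} (hA : (A 0).det ≠ 0) {n : ℕ}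
    (h : ∀ l ≤ n, A l = B l) : coeff n (logDetRatio A) = coeff n (logDetRatio B) := by
  have h0 : A 0 = B 0 := h 0 (Nat.zero_le n)
  refine coeff_logOf_congr (constantCoeff_ratio hA) (constantCoeff_ratio (h0 ▸ hA)) ?_
  rw [h0, ← mul_sub]
  refine Dvd.dvd.mul_left ?_ _
  -- Modulo `X ^ (n + 1)` the two matrices are equal, and reduction commutes with the determinant.
  rw [← Ideal.mem_span_singleton, ← Ideal.Quotient.mk_eq_mk_iff_sub_mem, RingHom.map_det,
    RingHom.map_det]
  congr 1
  ext i j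
  simp only [RingHom.mapMatrix_apply, Matrix.map_apply]
  rw [Ideal.Quotient.mk_eq_mk_iff_sub_mem, Ideal.mem_span_singleton, PowerSeries.X_pow_dvd_iff]
  intro l hl
  simp [seriesMatrix, h l (Nat.lt_succ_iff.1 hl)]

/-- The determinants of `P` and `Q` and the power of `c` cancel against those in the leading term;
what is left is the substitution t ↦ at. This one computation serves changes of coordinates,
dilations and parity. -/
theorem coeff_logDetRatio_scale {A B : ℕ → Matrix ι ι ℂ} {a c : ℂ} {P Q : Matrix ι ι ℂ}
    (hA : (A 0).det ≠ 0) (hB : (B 0).det ≠ 0)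
    (h : ∀ l, B l = (c * a ^ l) • (P * A l * Q)) (n : ℕ) :
    coeff n (logDetRatio B) = a ^ n * coeff n (logDetRatio A) := by
  have hM : seriesMatrix B = PowerSeries.C c •
      ((PowerSeries.C (R := ℂ)).mapMatrix P * (rescale a).mapMatrix (seriesMatrix A) *
        (PowerSeries.C (R := ℂ)).mapMatrix Q) := by
    ext i j l
    simp only [seriesMatrix, Matrix.of_apply, PowerSeries.coeff_mk, h l, Matrix.smul_apply,
      smul_eq_mul, Matrix.mul_apply, PowerSeries.coeff_C_mul, map_sum, RingHom.mapMatrix_apply,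
      Matrix.map_apply, PowerSeries.coeff_mul_C, PowerSeries.coeff_rescale, Finset.mul_sum,
      Finset.sum_mul]
    exact Finset.sum_congr rfl fun k _ => Finset.sum_congr rfl fun k' _ => by ring
  have h0 : (B 0).det = c ^ Fintype.card ι * (P.det * (A 0).det * Q.det) := by
    rw [h 0]
    simp
  have hdet : (seriesMatrix B).det = PowerSeries.C (c ^ Fintype.card ι * (P.det * Q.det)) *
      rescale a (seriesMatrix A).det := by
    rw [hM, Matrix.det_smul, Matrix.det_mul, Matrix.det_mul, ← RingHom.map_det, ← RingHom.map_det,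
      ← RingHom.map_det]
    simp only [map_mul, map_pow]
    ring
  have hr : PowerSeries.C (B 0).det⁻¹ * (seriesMatrix B).det =
      rescale a (PowerSeries.C (A 0).det⁻¹ * (seriesMatrix A).det) := by
    have hC : rescale a (PowerSeries.C (A 0).det⁻¹) = PowerSeries.C (A 0).det⁻¹ := by
      ext l
      rw [PowerSeries.coeff_rescale, PowerSeries.coeff_C]
      split_ifs with hl <;> simp [hl]
    rw [hdet, map_mul (rescale a), hC, ← mul_assoc, ← map_mul]
    congr 2
    rw [h0] at hB ⊢
    have h1 : c ^ Fintype.card ι ≠ 0 := left_ne_zero_of_mul hB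
    have h2 := right_ne_zero_of_mul hB
    have h3 : Q.det ≠ 0 := right_ne_zero_of_mul h2
    have h4 : P.det ≠ 0 := left_ne_zero_of_mul (left_ne_zero_of_mul h2)
    field_simp
  rw [logDetRatio, hr, logOf_rescale (constantCoeff_ratio hA), PowerSeries.coeff_rescale]
  rfl

/-- Conjugating the coefficients of a Hermitian series transposes the matrix, which leaves the
determinant unchanged. -/
theorem conj_coeff_logDetRatio {A : ℕ → Matrix ι ι ℂ} (hA : (A 0).det ≠ 0)
    (h : ∀ l, (A l).IsHermitian) (n : ℕ) :
    starRingEnd ℂ (coeff n (logDetRatio A)) = coeff n (logDetRatio A) := by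
  have hM : (PowerSeries.map (starRingEnd ℂ)).mapMatrix (seriesMatrix A) =
      (seriesMatrix A).transpose := by
    ext i j l
    simpa [seriesMatrix] using (h l).apply j i
  have h0 : starRingEnd ℂ (A 0).det = (A 0).det := by
    have := congrArg Matrix.det (h 0).eq
    rwa [Matrix.det_conjTranspose] at this
  rw [← PowerSeries.coeff_map, logDetRatio, ← logOf_map (constantCoeff_ratio hA)]
  congr 2
  rw [map_mul, RingHom.map_det, hM, Matrix.det_transpose, PowerSeries.map_C, map_inv₀, h0]

/-- A series with even terms only is invariant under t ↦ -t. -/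
theorem coeff_logDetRatio_odd {A : ℕ → Matrix ι ι ℂ} (hA : (A 0).det ≠ 0)
    (h : ∀ l, Odd l → A l = 0) {n : ℕ} (hn : Odd n) : coeff n (logDetRatio A) = 0 := by
  have := coeff_logDetRatio_scale (a := -1) (c := 1) (P := 1) (Q := 1) hA hA (fun l => by
    rcases Nat.even_or_odd l with hl | hl
    · simp [hl.neg_one_pow]
    · simp [h l hl]) n
  rw [hn.neg_one_pow] at this
  linear_combination this / 2

variable {X : Type*} [NormedAddCommGroup X] [NormedSpace ℝ X]

/-- The coefficients of a family of power series are smooth at `x`. -/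
def SmoothCoeffAt (P : X → PowerSeries ℂ) (x : X) : Prop :=
  ∀ n, ContDiffAt ℝ ∞ (fun y => coeff n (P y)) x

theorem SmoothCoeffAt.const (p : PowerSeries ℂ) (x : X) : SmoothCoeffAt (fun _ => p) x :=
  fun _ => contDiffAt_const

theorem SmoothCoeffAt.C {f : X → ℂ} {x : X} (hf : ContDiffAt ℝ ∞ f x) :
    SmoothCoeffAt (fun y => PowerSeries.C (f y)) x := fun n => by
  simp only [PowerSeries.coeff_C]
  split_ifs
  · exact hf
  · exact contDiffAt_const

theorem SmoothCoeffAt.sub {P Q : X → PowerSeries ℂ} {x : X} (hP : SmoothCoeffAt P x)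
    (hQ : SmoothCoeffAt Q x) : SmoothCoeffAt (fun y => P y - Q y) x := fun n => by
  simpa using (hP n).sub (hQ n)

theorem SmoothCoeffAt.mul {P Q : X → PowerSeries ℂ} {x : X} (hP : SmoothCoeffAt P x)
    (hQ : SmoothCoeffAt Q x) : SmoothCoeffAt (fun y => P y * Q y) x := fun n => by
  simp only [PowerSeries.coeff_mul]
  exact ContDiffAt.sum fun p _ => (hP p.1).mul (hQ p.2)

theorem SmoothCoeffAt.pow {P : X → PowerSeries ℂ} {x : X} (hP : SmoothCoeffAt P x) (d : ℕ) :
    SmoothCoeffAt (fun y => P y ^ d) x := by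
  induction d with
  | zero => simpa using SmoothCoeffAt.const 1 x
  | succ d ih => simpa only [pow_succ] using ih.mul hP

theorem SmoothCoeffAt.sum {κ : Type*} (s : Finset κ) {P : κ → X → PowerSeries ℂ} {x : X}
    (hP : ∀ i ∈ s, SmoothCoeffAt (P i) x) : SmoothCoeffAt (fun y => ∑ i ∈ s, P i y) x := fun n => by
  simp only [map_sum]
  exact ContDiffAt.sum fun i hi => hP i hi n

theorem SmoothCoeffAt.prod {κ : Type*} (s : Finset κ) {P : κ → X → PowerSeries ℂ} {x : X}
    (hP : ∀ i ∈ s, SmoothCoeffAt (P i) x) : SmoothCoeffAt (fun y => ∏ i ∈ s, P i y) x := by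
  induction s using Finset.cons_induction with
  | empty => simpa using SmoothCoeffAt.const 1 x
  | cons i s hi ih =>
    simp only [Finset.prod_cons]
    exact (hP i (by simp)).mul (ih fun j hj => hP j (by simp [hj]))

theorem SmoothCoeffAt.det {M : X → Matrix ι ι (PowerSeries ℂ)} {x : X}
    (hM : ∀ i j, SmoothCoeffAt (fun y => M y i j) x) : SmoothCoeffAt (fun y => (M y).det) x := by
  simp only [Matrix.det_apply']
  exact SmoothCoeffAt.sum _ fun σ _ =>
    (SmoothCoeffAt.const _ x).mul (SmoothCoeffAt.prod _ fun i _ => hM _ _)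

theorem SmoothCoeffAt.logOf {P : X → PowerSeries ℂ} {x : X} (hP : SmoothCoeffAt P x)
    (h1 : ∀ᶠ y in nhds x, constantCoeff (P y) = 1) :
    SmoothCoeffAt (fun y => PowerSeries.logOf (P y)) x := fun n => by
  have : ContDiffAt ℝ ∞ (fun y => ∑ d ∈ Finset.range (n + 1),
      coeff d (PowerSeries.log ℂ) * coeff n ((P y - 1) ^ d)) x :=
    ContDiffAt.sum fun d _ =>
      contDiffAt_const.mul ((hP.sub (SmoothCoeffAt.const 1 x)).pow d n)
  exact this.congr_of_eventuallyEq (h1.mono fun y hy => coeff_logOf hy n)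

theorem contDiffAt_det {𝕜 : Type*} [NontriviallyNormedField 𝕜] [NormedAlgebra 𝕜 ℂ]
    {Z : Type*} [NormedAddCommGroup Z] [NormedSpace 𝕜 Z] {n : ℕ∞ω} {M : Z → Matrix ι ι ℂ} {x : Z}
    (hM : ∀ i j, ContDiffAt 𝕜 n (fun y => M y i j) x) : ContDiffAt 𝕜 n (fun y => (M y).det) x := by
  simp only [Matrix.det_apply']
  exact ContDiffAt.sum fun σ _ => contDiffAt_const.mul (contDiffAt_prod fun i _ => hM _ _)

theorem contDiffAt_coeff_logDetRatio {A : ℕ → X → Matrix ι ι ℂ} {x : X}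
    (hA : ∀ l i j, ContDiffAt ℝ ∞ (fun y => A l y i j) x) (h0 : (A 0 x).det ≠ 0) (n : ℕ) :
    ContDiffAt ℝ ∞ (fun y => coeff n (logDetRatio fun l => A l y)) x := by
  have hd : ContDiffAt ℝ ∞ (fun y => (A 0 y).det) x := contDiffAt_det (hA 0)
  refine SmoothCoeffAt.logOf ((SmoothCoeffAt.C (hd.inv h0)).mul
    (SmoothCoeffAt.det fun i j l => ?_)) ?_ n
  · simpa [seriesMatrix] using hA l i j
  · filter_upwards [hd.continuousAt.eventually_ne h0] with y hy
    exact constantCoeff_ratio (A := fun l => A l y) hy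

end Series

/-! ### The formal form and its Ricci form in one coordinate domain. -/

section LocalForm

open PowerSeries (coeff)

variable {X : Type*} [NormedAddCommGroup X] [NormedSpace ℂ X] {ι : Type*} [Fintype ι]
  [DecidableEq ι]

/-- The parts of each weight of `√-1 ∂∂̄ρ - Ric(√-1 ∂∂̄ρ) + √-1 ∂∂̄ ∑_{k > 0} υ_k` in coordinates. -/
def localForm (b : ι → X) (ρ : X → ℝ) (υ : ℕ → X → ℝ) (k : ℤ) (y : X) : Matrix ι ι ℂ :=
  if k = -2 then ddbar b (fun y' => (ρ y' : ℂ)) y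
  else if k = 0 then -ricci b (ddbar b fun y' => (ρ y' : ℂ)) y
  else if 0 < k then ddbar b (fun y' => (υ k.toNat y' : ℂ)) y
  else 0

theorem localForm_neg_two (b : ι → X) (ρ : X → ℝ) (υ : ℕ → X → ℝ) (y : X) :
    localForm b ρ υ (-2) y = ddbar b (fun y' => (ρ y' : ℂ)) y := by simp [localForm]

theorem localForm_pos (b : ι → X) (ρ : X → ℝ) (υ : ℕ → X → ℝ) {k : ℕ} (hk : 0 < k) (y : X) :
    localForm b ρ υ k y = ddbar b (fun y' => (υ k y' : ℂ)) y := by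
  simp [localForm, hk, hk.ne', show (k : ℤ) ≠ -2 by lia]

theorem localForm_eq_zero (b : ι → X) (ρ : X → ℝ) (υ : ℕ → X → ℝ) {k : ℤ} (h2 : k ≠ -2)
    (hk : k < 0) (y : X) : localForm b ρ υ k y = 0 := by
  simp [localForm, h2, hk.ne, hk.not_gt]

/-- The real function `log |det (√-1 ∂∂̄ρ)|`. -/
def logNormDet (b : ι → X) (ρ : X → ℝ) (y : X) : ℝ :=
  Real.log ‖(ddbar b (fun y' => (ρ y' : ℂ)) y).det‖

/-- On the open set `S` the functions `ρ` and `υ k` are smooth, and `√-1 ∂∂̄ρ` is positive. -/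
structure IsAdmissible (b : ι → X) (ρ : X → ℝ) (υ : ℕ → X → ℝ) (S : Set X) : Prop where
  isOpen : IsOpen S
  smooth : ∀ y ∈ S, ContDiffAt ℝ ∞ (fun y' => (ρ y' : ℂ)) y
  smooth_pot : ∀ k : ℕ, 0 < k → ∀ y ∈ S, ContDiffAt ℝ ∞ (fun y' => (υ k y' : ℂ)) y
  pos : ∀ y ∈ S, (ddbar b (fun y' => (ρ y' : ℂ)) y).PosDef

variable {b : ι → X} {ρ : X → ℝ} {υ : ℕ → X → ℝ} {S : Set X}

theorem two_le_infty : (2 : ℕ∞ω) ≤ ∞ := WithTop.coe_le_coe.2 le_top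

theorem contDiffAt_two {f : X → ℂ} {x : X} (hf : ContDiffAt ℝ ∞ f x) : ContDiffAt ℝ 2 f x :=
  hf.of_le two_le_infty

theorem IsAdmissible.det_ne_zero (h : IsAdmissible b ρ υ S) {y : X} (hy : y ∈ S) :
    (ddbar b (fun y' => (ρ y' : ℂ)) y).det ≠ 0 :=
  (h.pos y hy).det_pos.ne'

/-- A positive definite matrix has positive determinant, so the principal complex logarithm is the
real one. The version with the norm splits over products without branch problems. -/
theorem IsAdmissible.log_det (h : IsAdmissible b ρ υ S) {y : X} (hy : y ∈ S) :
    Complex.log (ddbar b (fun y' => (ρ y' : ℂ)) y).det = (logNormDet b ρ y : ℂ) := by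
  have hp := (h.pos y hy).det_pos
  obtain ⟨d, hd⟩ : ∃ d : ℝ, (d : ℂ) = (ddbar b (fun y' => (ρ y' : ℂ)) y).det :=
    ⟨_, (Complex.eq_re_of_ofReal_le hp.le).symm⟩
  rw [← hd] at hp
  rw [logNormDet, ← hd]
  have hd0 : 0 < d := by exact_mod_cast hp
  rw [← Complex.ofReal_log hd0.le, Complex.norm_real, Real.norm_eq_abs, Real.log_abs]

theorem IsAdmissible.eventually_mem (h : IsAdmissible b ρ υ S) {y : X} (hy : y ∈ S) :
    ∀ᶠ y' in nhds y, y' ∈ S :=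
  h.isOpen.mem_nhds hy

theorem IsAdmissible.contDiffAt_logNormDet (h : IsAdmissible b ρ υ S) {y : X} (hy : y ∈ S) :
    ContDiffAt ℝ ∞ (fun y' => (logNormDet b ρ y' : ℂ)) y := by
  have hd : ContDiffAt ℝ ∞ (fun y' => (ddbar b (fun y' => (ρ y' : ℂ)) y').det) y :=
    contDiffAt_det fun i j => contDiffAt_levi (h.smooth y hy) _ _
  have h2 : ContDiffAt ℝ ∞ (logNormDet b ρ) y :=
    (hd.norm ℝ (h.det_ne_zero hy)).log (by simpa using h.det_ne_zero hy)
  exact Complex.ofRealCLM.contDiff.contDiffAt.comp y h2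

theorem IsAdmissible.localForm_zero (h : IsAdmissible b ρ υ S) {y : X} (hy : y ∈ S) :
    localForm b ρ υ 0 y = ddbar b (fun y' => (logNormDet b ρ y' : ℂ)) y := by
  simp only [localForm, ricci, neg_neg]
  simp only [show ((0 : ℤ) = -2) = False by simp, if_false, if_true]
  exact ddbar_congr b ((h.eventually_mem hy).mono fun y' hy' => h.log_det hy')

/-- Each nonzero part of a local form is of the form `√-1 ∂∂̄f` with `f` real. -/
theorem IsAdmissible.exists_potential (h : IsAdmissible b ρ υ S) (k : ℤ) :
    ∃ f : X → ℝ, (∀ y ∈ S, ContDiffAt ℝ ∞ (fun y' => (f y' : ℂ)) y) ∧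
      ∀ y ∈ S, localForm b ρ υ k y = ddbar b (fun y' => (f y' : ℂ)) y := by
  by_cases h2 : k = -2
  · subst h2
    exact ⟨ρ, h.smooth, fun y _ => localForm_neg_two b ρ υ y⟩
  by_cases h0 : k = 0
  · subst h0
    exact ⟨logNormDet b ρ, fun y hy => h.contDiffAt_logNormDet hy, fun y hy => h.localForm_zero hy⟩
  by_cases hk : 0 < k
  · lift k to ℕ using hk.le
    have hk : 0 < k := by exact_mod_cast hk
    exact ⟨υ k, h.smooth_pot k hk, fun y _ => localForm_pos b ρ υ hk y⟩
  · refine ⟨fun _ => 0, fun y _ => contDiffAt_const, fun y _ => ?_⟩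
    rw [localForm_eq_zero b ρ υ h2 (by lia)]
    ext i j
    exact (levi_const _ _ _ _).symm

theorem isHermitian_ddbar {f : X → ℝ} {y : X} (hf : ContDiffAt ℝ 2 (fun y' => (f y' : ℂ)) y) :
    (ddbar b (fun y' => (f y' : ℂ)) y).IsHermitian := by
  ext i j
  exact levi_ofReal_symm hf _ _

theorem IsAdmissible.isHermitian (h : IsAdmissible b ρ υ S) (k : ℤ) {y : X} (hy : y ∈ S) :
    (localForm b ρ υ k y).IsHermitian := by
  obtain ⟨f, hf, he⟩ := h.exists_potential k
  rw [he y hy]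
  exact isHermitian_ddbar (contDiffAt_two (hf y hy))

theorem IsAdmissible.contDiffAt_localForm (h : IsAdmissible b ρ υ S) (k : ℤ) {y : X} (hy : y ∈ S)
    (i j : ι) : ContDiffAt ℝ ∞ (fun y' => localForm b ρ υ k y' i j) y := by
  obtain ⟨f, hf, he⟩ := h.exists_potential k
  exact (contDiffAt_levi (hf y hy) (b i) (b j)).congr_of_eventuallyEq
    ((h.eventually_mem hy).mono fun y' hy' => congrFun (congrFun (he y' hy') i) j)

/-- The coefficients of `log (det Ω / det Ω_(-2))` for the local form `Ω`. -/
def logDetCoeff (b : ι → X) (ρ : X → ℝ) (υ : ℕ → X → ℝ) (n : ℕ) (y : X) : ℂ :=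
  coeff n (logDetRatio fun l => localForm b ρ υ ((l : ℤ) - 2) y)

theorem IsAdmissible.det_localForm_ne_zero (h : IsAdmissible b ρ υ S) {y : X} (hy : y ∈ S) :
    (localForm b ρ υ (((0 : ℕ) : ℤ) - 2) y).det ≠ 0 := by
  rw [show (((0 : ℕ) : ℤ) - 2) = -2 by norm_num, localForm_neg_two]
  exact h.det_ne_zero hy

theorem IsAdmissible.contDiffAt_logDetCoeff (h : IsAdmissible b ρ υ S) (n : ℕ) {y : X}
    (hy : y ∈ S) : ContDiffAt ℝ ∞ (logDetCoeff b ρ υ n) y :=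
  contDiffAt_coeff_logDetRatio (A := fun l y => localForm b ρ υ ((l : ℤ) - 2) y)
    (fun l i j => h.contDiffAt_localForm ((l : ℤ) - 2) hy i j) (h.det_localForm_ne_zero hy) n

theorem IsAdmissible.logDetCoeff_real (h : IsAdmissible b ρ υ S) (n : ℕ) {y : X} (hy : y ∈ S) :
    ((logDetCoeff b ρ υ n y).re : ℂ) = logDetCoeff b ρ υ n y :=
  Complex.conj_eq_iff_re.1 <| conj_coeff_logDetRatio
    (A := fun l => localForm b ρ υ ((l : ℤ) - 2) y) (h.det_localForm_ne_zero hy)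
    (fun l => h.isHermitian ((l : ℤ) - 2) hy) n

theorem IsAdmissible.logDetCoeff_odd (h : IsAdmissible b ρ υ S)
    (hυ : ∀ k, Odd k → ∀ y ∈ S, υ k y = 0) {n : ℕ} (hn : Odd n) {y : X} (hy : y ∈ S) :
    logDetCoeff b ρ υ n y = 0 := by
  refine coeff_logDetRatio_odd (h.det_localForm_ne_zero hy) (fun l hl => ?_) hn
  obtain ⟨c, rfl⟩ := hl
  -- For `l = 1` the weight is -1, where the form is zero by definition; larger odd `l` give the odd
  -- positive weight `l - 2`.
  rcases Nat.eq_zero_or_pos c with rfl | hc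
  · exact localForm_eq_zero b ρ υ (by simp) (by simp) y
  · have e : (((2 * c + 1 : ℕ) : ℤ) - 2) = ((2 * (c - 1) + 1 : ℕ) : ℤ) := by lia
    rw [e, localForm_pos b ρ υ (by lia)]
    ext i j
    have : (fun y' => (υ (2 * (c - 1) + 1) y' : ℂ)) =ᶠ[nhds y] fun _ => 0 :=
      (h.eventually_mem hy).mono fun y' hy' => by simp [hυ _ (odd_two_mul_add_one _) y' hy']
    rw [ddbar_apply, levi_congr this, levi_const]
    rfl

/-- Index `l ≤ n` of the series is weight `l - 2 < n`, so the coefficient of weight `n` does not see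
the potential of weight `n`. This makes the soliton equation a recursion. -/
theorem IsAdmissible.logDetCoeff_congr (h : IsAdmissible b ρ υ S) {υ' : ℕ → X → ℝ} {n : ℕ}
    (hυ : ∀ k, 0 < k → k < n → ∀ y ∈ S, υ k y = υ' k y) {y : X} (hy : y ∈ S) :
    logDetCoeff b ρ υ n y = logDetCoeff b ρ υ' n y := by
  refine coeff_logDetRatio_congr (h.det_localForm_ne_zero hy) fun l hl => ?_
  by_cases hl2 : 2 < l
  · obtain ⟨k, rfl⟩ := Nat.exists_eq_add_of_lt hl2
    have e : (((2 + k + 1 : ℕ) : ℤ) - 2) = ((k + 1 : ℕ) : ℤ) := by lia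
    rw [e, localForm_pos b ρ υ k.succ_pos, localForm_pos b ρ υ' k.succ_pos]
    refine ddbar_congr b ((h.eventually_mem hy).mono fun y' hy' => ?_)
    simp only [hυ (k + 1) k.succ_pos (by lia) y' hy']
  · have : ¬ 0 < ((l : ℤ) - 2) := by lia
    simp only [localForm, this, if_false]

theorem IsAdmissible.coeff_formalLogDet (h : IsAdmissible b ρ υ S) (n : ℕ) {y : X} (hy : y ∈ S) :
    coeff n (formalLogDet (localForm b ρ υ) y) =
      if n = 0 then (logNormDet b ρ y : ℂ) else logDetCoeff b ρ υ n y := by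
  rw [formalLogDet_eq, map_add, PowerSeries.coeff_C, localForm_neg_two]
  split_ifs with hn
  · subst hn
    rw [h.log_det hy, PowerSeries.coeff_zero_eq_constantCoeff_apply,
      constantCoeff_logDetRatio (h.det_localForm_ne_zero hy), add_zero]
  · rw [zero_add]
    rfl

theorem IsAdmissible.formalRicci_zero (h : IsAdmissible b ρ υ S) {y : X} (hy : y ∈ S) :
    formalRicci b (localForm b ρ υ) 0 y = -localForm b ρ υ 0 y := by
  rw [formalRicci, if_pos le_rfl, h.localForm_zero hy]
  refine congrArg _ (ddbar_congr b ((h.eventually_mem hy).mono fun y' hy' => ?_))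
  simpa using h.coeff_formalLogDet 0 hy'

theorem IsAdmissible.formalRicci_pos (h : IsAdmissible b ρ υ S) {k : ℕ} (hk : 0 < k) {y : X}
    (hy : y ∈ S) :
    formalRicci b (localForm b ρ υ) k y = -ddbar b (logDetCoeff b ρ υ k) y := by
  rw [formalRicci, if_pos (Int.natCast_nonneg k)]
  refine congrArg _ (ddbar_congr b ((h.eventually_mem hy).mono fun y' hy' => ?_))
  simpa [hk.ne'] using h.coeff_formalLogDet k hy'

/-! ### Behaviour under holomorphic maps that rescale the potentials. -/

section Pullback

variable (b) in
/-- The Jacobian matrix of `T` in the coordinates `e`. -/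
def jacobian (e : X →L[ℂ] ι → ℂ) (T : X → X) (y : X) : Matrix ι ι ℂ :=
  Matrix.of fun k i => e (fderiv ℂ T y (b i)) k

theorem ddbar_comp {e : X →L[ℂ] ι → ℂ} (he : ∀ v, v = ∑ i, e v i • b i) {F : X → ℂ} {T : X → X}
    {y : X} (hF : ContDiffAt ℝ 2 F (T y)) (hT : ContDiffAt ℂ 2 T y) :
    ddbar b (fun y => F (T y)) y =
      (jacobian b e T y).transpose * ddbar b F (T y) * (jacobian b e T y).map (starRingEnd ℂ) := by
  ext i j
  rw [ddbar_apply, levi_comp hF hT, he (fderiv ℂ T y (b i)), he (fderiv ℂ T y (b j)), levi_sum hF,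
    Finset.sum_comm]
  simp only [Matrix.mul_apply, Finset.sum_mul, jacobian, Matrix.transpose_apply, Matrix.of_apply,
    Matrix.map_apply, ddbar_apply]
  exact Finset.sum_congr rfl fun k _ => Finset.sum_congr rfl fun l _ => by ring

variable {ρ' : X → ℝ} {υ' : ℕ → X → ℝ} {S' : Set X} {e : X →L[ℂ] ι → ℂ} {T : X → X} {y₀ : X} {a : ℝ}

theorem contDiffAt_jacobian (hT : ContDiffAt ℂ ∞ T y₀) (k i : ι) :
    ContDiffAt ℂ ∞ (fun y => jacobian b e T y k i) y₀ := by
  have h1 : ContDiffAt ℂ ∞ (fun y => e (fderiv ℂ T y (b i))) y₀ :=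
    e.contDiff.contDiffAt.comp y₀
      ((hT.fderiv_right (m := ∞) (by simp)).clm_apply contDiffAt_const)
  exact contDiffAt_pi.1 h1 k

theorem ddbar_const_mul (c : ℂ) (f : X → ℂ) (y : X) :
    ddbar b (fun y => c * f y) y = c • ddbar b f y := by
  ext i j
  exact levi_const_mul c f _ _ y

theorem ddbar_scaled_comp (he : ∀ v, v = ∑ i, e v i • b i) {f f' : X → ℝ} {c : ℝ}
    (hf : ContDiffAt ℝ ∞ (fun y => (f y : ℂ)) (T y₀)) (hT : ContDiffAt ℂ 2 T y₀)
    (h : ∀ᶠ y in nhds y₀, f' y = c * f (T y)) :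
    ddbar b (fun y => (f' y : ℂ)) y₀ = (c : ℂ) • ((jacobian b e T y₀).transpose *
      ddbar b (fun y => (f y : ℂ)) (T y₀) * (jacobian b e T y₀).map (starRingEnd ℂ)) := by
  have : (fun y => (f' y : ℂ)) =ᶠ[nhds y₀] fun y => (c : ℂ) * (f (T y) : ℂ) :=
    h.mono fun y hy => by simp [hy]
  rw [ddbar_congr b this, ddbar_const_mul]
  congr 1
  exact ddbar_comp (F := fun y => (f y : ℂ)) he (contDiffAt_two hf) hT

/-- Used with `a = 1` for changes of coordinates and with `a = |c|⁻¹` for dilations. Only weight 0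
needs an argument: log det changes by a constant and by 2 log|det J|, which is pluriharmonic. -/
theorem localForm_comp (h : IsAdmissible b ρ υ S) (h' : IsAdmissible b ρ' υ' S')
    (he : ∀ v, v = ∑ i, e v i • b i) (hy : y₀ ∈ S') (hTy : T y₀ ∈ S) (hT : ContDiffAt ℂ ∞ T y₀)
    (hρ : ∀ᶠ y in nhds y₀, ρ' y = a ^ (-2 : ℤ) * ρ (T y))
    (hυ : ∀ k, 0 < k → ∀ᶠ y in nhds y₀, υ' k y = a ^ k * υ k (T y)) (k : ℤ) :
    localForm b ρ' υ' k y₀ = (a : ℂ) ^ k • ((jacobian b e T y₀).transpose *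
      localForm b ρ υ k (T y₀) * (jacobian b e T y₀).map (starRingEnd ℂ)) := by
  have hT2 : ContDiffAt ℂ 2 T y₀ := hT.of_le two_le_infty
  have hform : ∀ᶠ y in nhds y₀, ddbar b (fun y => (ρ' y : ℂ)) y =
      ((a ^ (-2 : ℤ) : ℝ) : ℂ) • ((jacobian b e T y).transpose *
      ddbar b (fun y => (ρ y : ℂ)) (T y) * (jacobian b e T y).map (starRingEnd ℂ)) := by
    filter_upwards [hρ.eventually_nhds, hT.continuousAt.eventually (h.eventually_mem hTy),
      hT2.eventually (by simp)] with y h1 h2 h3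
    exact ddbar_scaled_comp he (h.smooth _ h2) h3 h1
  by_cases h2 : k = -2
  · subst h2
    rw [localForm_neg_two, localForm_neg_two, hform.self_of_nhds]
    push_cast
    rfl
  by_cases h0 : k = 0
  · subst h0
    rw [h'.localForm_zero hy, h.localForm_zero hTy, zpow_zero, one_smul,
      ← ddbar_comp (F := fun y => (logNormDet b ρ y : ℂ)) he
        (contDiffAt_two (h.contDiffAt_logNormDet hTy)) hT2]
    obtain ⟨c, hc⟩ : ∃ c, c = Real.log ‖(((a ^ (-2 : ℤ) : ℝ) : ℂ)) ^ Fintype.card ι‖ := ⟨_, rfl⟩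
    have hj : ContDiffAt ℂ ∞ (fun y => (jacobian b e T y).det) y₀ :=
      contDiffAt_det fun k i => contDiffAt_jacobian hT k i
    have hdet : ∀ᶠ y in nhds y₀, (ddbar b (fun y => (ρ' y : ℂ)) y).det =
        ((a ^ (-2 : ℤ) : ℝ) : ℂ) ^ Fintype.card ι * ((jacobian b e T y).det *
          (ddbar b (fun y => (ρ y : ℂ)) (T y)).det * starRingEnd ℂ (jacobian b e T y).det) := by
      filter_upwards [hform] with y hy
      rw [hy, Matrix.det_smul, Matrix.det_mul, Matrix.det_mul, Matrix.det_transpose,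
        RingHom.map_det]
      rfl
    -- No invertibility of `T` is assumed; a singular Jacobian would make the pulled back form
    -- degenerate, against its positivity.
    have hj0 : (jacobian b e T y₀).det ≠ 0 := by
      intro h0
      have := hdet.self_of_nhds
      rw [h0] at this
      simp only [zero_mul, mul_zero] at this
      exact h'.det_ne_zero hy this
    have hlog : (fun y => (logNormDet b ρ' y : ℂ)) =ᶠ[nhds y₀] fun y =>
        ((c : ℂ) + 2 * ((Real.log ‖(jacobian b e T y).det‖ : ℝ) : ℂ)) +
          (logNormDet b ρ (T y) : ℂ) := by
      filter_upwards [hdet, h'.eventually_mem hy, hT.continuousAt.eventually (h.eventually_mem hTy),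
        hj.continuousAt.eventually_ne hj0] with y h1 h2 h3 h4
      have e1 := h'.det_ne_zero h2
      rw [h1] at e1
      have e2 := norm_ne_zero_iff.2 (left_ne_zero_of_mul e1)
      have e3 := norm_ne_zero_iff.2 h4
      have e4 := norm_ne_zero_iff.2 (h.det_ne_zero h3)
      rw [logNormDet, h1, norm_mul, norm_mul, norm_mul, RCLike.norm_conj,
        Real.log_mul e2 (by positivity), Real.log_mul (by positivity) e3, Real.log_mul e3 e4,
        logNormDet, hc]
      simp only [Complex.ofReal_add]
      ring
    ext i j
    have hnj : ContDiffAt ℝ 2 (fun y => ((Real.log ‖(jacobian b e T y).det‖ : ℝ) : ℂ)) y₀ :=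
      contDiffAt_two <| Complex.ofRealCLM.contDiff.contDiffAt.comp y₀ <|
        ((hj.restrict_scalars ℝ).norm ℝ hj0).log (by simpa using hj0)
    have hlT : ContDiffAt ℝ 2 (fun y => (logNormDet b ρ (T y) : ℂ)) y₀ :=
      (contDiffAt_two (h.contDiffAt_logNormDet hTy)).comp y₀ (hT2.restrict_scalars ℝ)
    rw [ddbar_apply, levi_congr hlog,
      levi_add (contDiffAt_const.add (contDiffAt_const.mul hnj)) hlT,
      levi_add contDiffAt_const (contDiffAt_const.mul hnj), levi_const, levi_const_mul,
      levi_log_norm (hj.of_le two_le_infty) hj0]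
    simp [ddbar_apply]
  by_cases hk : 0 < k
  · lift k to ℕ using hk.le
    have hk : 0 < k := by exact_mod_cast hk
    rw [localForm_pos b ρ' υ' hk, localForm_pos b ρ υ hk,
      ddbar_scaled_comp he (h.smooth_pot k hk _ hTy) hT2 (hυ k hk)]
    push_cast
    rfl
  · rw [localForm_eq_zero b ρ' υ' h2 (by lia), localForm_eq_zero b ρ υ h2 (by lia)]
    simp

theorem logDetCoeff_comp (h : IsAdmissible b ρ υ S) (h' : IsAdmissible b ρ' υ' S')
    (he : ∀ v, v = ∑ i, e v i • b i) (hy : y₀ ∈ S') (hTy : T y₀ ∈ S) (hT : ContDiffAt ℂ ∞ T y₀)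
    (ha : a ≠ 0) (hρ : ∀ᶠ y in nhds y₀, ρ' y = a ^ (-2 : ℤ) * ρ (T y))
    (hυ : ∀ k, 0 < k → ∀ᶠ y in nhds y₀, υ' k y = a ^ k * υ k (T y)) (n : ℕ) :
    logDetCoeff b ρ' υ' n y₀ = (a : ℂ) ^ n * logDetCoeff b ρ υ n (T y₀) := by
  -- Index `l` has weight `l - 2`, hence the common factor `a ^ (-2)`.
  refine coeff_logDetRatio_scale (c := (a : ℂ) ^ (-2 : ℤ)) (P := (jacobian b e T y₀).transpose)
    (Q := (jacobian b e T y₀).map (starRingEnd ℂ)) (h.det_localForm_ne_zero hTy)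
    (h'.det_localForm_ne_zero hy) (fun l => ?_) n
  rw [localForm_comp h h' he hy hTy hT hρ hυ, sub_eq_neg_add,
    zpow_add₀ (by exact_mod_cast ha), zpow_natCast]

end Pullback

end LocalForm

/-! ### Local coordinates on the total space and their transition maps. -/

section Coordinates

variable {m : ℕ} {D : Type*} [TopologicalSpace D] [ChartedSpace (EuclideanSpace ℂ (Fin m)) D]
  {E : D → Type*} [∀ x, AddCommGroup (E x)] [∀ x, Module ℂ (E x)]
  [TopologicalSpace (Bundle.TotalSpace ℂ E)] [∀ x, TopologicalSpace (E x)]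
  [FiberBundle ℂ E] [VectorBundle ℂ ℂ E]

/-- Scalar multiplication on the fibres. -/
def fibreSmul (c : ℂ) (p : Bundle.TotalSpace ℂ E) : Bundle.TotalSpace ℂ E := ⟨p.1, c • p.2⟩

theorem fibreSmul_mem {c : ℂ} (hc : c ≠ 0) {p : Bundle.TotalSpace ℂ E}
    (hp : p ∈ puncturedTotal E) : fibreSmul c p ∈ puncturedTotal E :=
  smul_ne_zero hc hp

variable (E) in
/-- The coordinates `(w, z)` of a point of the total space. -/
def coords (x₀ : D) (p : Bundle.TotalSpace ℂ E) : EuclideanSpace ℂ (Fin m) × ℂ :=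
  (chartAt (EuclideanSpace ℂ (Fin m)) x₀ p.1, (trivializationAt ℂ E x₀ p).2)

variable (E) in
theorem isOpen_baseDomain (x₀ : D) : IsOpen (baseDomain (m := m) E x₀) :=
  (chartAt (EuclideanSpace ℂ (Fin m)) x₀).isOpen_inter_preimage_symm
    (trivializationAt ℂ E x₀).open_baseSet

variable (E) in
theorem isOpen_coordDomain (x₀ : D) : IsOpen (coordDomain (m := m) E x₀) :=
  ((isOpen_baseDomain E x₀).preimage continuous_fst).inter
    (isOpen_ne.preimage continuous_snd)

theorem param_eq {x₀ : D} {y : EuclideanSpace ℂ (Fin m) × ℂ} (hy : y.1 ∈ baseDomain E x₀) :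
    param E x₀ y = ⟨(chartAt (EuclideanSpace ℂ (Fin m)) x₀).symm y.1,
      (trivializationAt ℂ E x₀).symmₗ ℂ ((chartAt (EuclideanSpace ℂ (Fin m)) x₀).symm y.1) y.2⟩ := by
  rw [Bundle.Trivialization.symmₗ_apply (R := ℂ) _ hy.2, Bundle.Trivialization.mk_symm _ hy.2]
  rfl

theorem param_mul {x₀ : D} {y : EuclideanSpace ℂ (Fin m) × ℂ} (hy : y.1 ∈ baseDomain E x₀)
    (c : ℂ) : param E x₀ (y.1, c * y.2) = fibreSmul c (param E x₀ y) := by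
  rw [param_eq hy, param_eq (y := (y.1, c * y.2)) hy, fibreSmul]
  simp only [← smul_eq_mul, map_smul]

theorem param_eq_fibreSmul {x₀ : D} {y : EuclideanSpace ℂ (Fin m) × ℂ}
    (hy : y.1 ∈ baseDomain E x₀) :
    param E x₀ y = fibreSmul y.2 (param E x₀ (y.1, 1)) := by
  rw [← param_mul (y := (y.1, 1)) hy, mul_one]

theorem trivializationAt_param {x₀ : D} {y : EuclideanSpace ℂ (Fin m) × ℂ}
    (hy : y.1 ∈ baseDomain E x₀) : trivializationAt ℂ E x₀ (param E x₀ y) =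
      ((chartAt (EuclideanSpace ℂ (Fin m)) x₀).symm y.1, y.2) :=
  (trivializationAt ℂ E x₀).apply_symm_apply' hy.2

theorem param_fst {x₀ : D} {y : EuclideanSpace ℂ (Fin m) × ℂ} (hy : y.1 ∈ baseDomain E x₀) :
    (param E x₀ y).1 = (chartAt (EuclideanSpace ℂ (Fin m)) x₀).symm y.1 := by
  rw [param_eq hy]

theorem coords_param {x₀ : D} {y : EuclideanSpace ℂ (Fin m) × ℂ} (hy : y.1 ∈ baseDomain E x₀) :
    coords E x₀ (param E x₀ y) = y := by
  rw [coords, trivializationAt_param hy, param_fst hy, OpenPartialHomeomorph.right_inv _ hy.1]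

theorem param_mem {x₀ : D} {y : EuclideanSpace ℂ (Fin m) × ℂ} (hy : y ∈ coordDomain E x₀) :
    param E x₀ y ∈ puncturedTotal E := by
  intro h
  have h1 := congrArg Prod.snd (trivializationAt_param hy.1)
  apply hy.2
  rw [← h1]
  have : param E x₀ y = ⟨(param E x₀ y).1, 0⟩ := by rw [← h]
  rw [this]
  have hb : (param E x₀ y).1 ∈ (trivializationAt ℂ E x₀).baseSet := by
    rw [param_fst hy.1]
    exact hy.1.2
  exact congrArg Prod.snd ((trivializationAt ℂ E x₀).zeroSection ℂ hb)

theorem param_coords {x₀ : D} {p : Bundle.TotalSpace ℂ E}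
    (h1 : p.1 ∈ (chartAt (EuclideanSpace ℂ (Fin m)) x₀).source)
    (h2 : p.1 ∈ (trivializationAt ℂ E x₀).baseSet) :
    (coords (m := m) E x₀ p).1 ∈ baseDomain E x₀ ∧ param E x₀ (coords (m := m) E x₀ p) = p := by
  refine ⟨⟨OpenPartialHomeomorph.map_source _ h1, ?_⟩, ?_⟩
  · simpa only [coords, OpenPartialHomeomorph.left_inv _ h1] using h2
  · simp only [param, coords, OpenPartialHomeomorph.left_inv _ h1]
    exact (trivializationAt ℂ E x₀).symm_apply_mk_proj
      ((trivializationAt ℂ E x₀).mem_source.2 h2)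

theorem coords_mem {x₀ : D} {p : Bundle.TotalSpace ℂ E}
    (h1 : p.1 ∈ (chartAt (EuclideanSpace ℂ (Fin m)) x₀).source)
    (h2 : p.1 ∈ (trivializationAt ℂ E x₀).baseSet) (hp : p ∈ puncturedTotal E) :
    coords (m := m) E x₀ p ∈ coordDomain E x₀ := by
  obtain ⟨hb, he⟩ := param_coords h1 h2
  refine ⟨hb, fun h0 => hp ?_⟩
  have := param_eq_fibreSmul hb
  rw [he, h0] at this
  rw [this]
  exact zero_smul ℂ _

theorem exists_param_eq {p : Bundle.TotalSpace ℂ E} (hp : p ∈ puncturedTotal E) :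
    ∃ y : EuclideanSpace ℂ (Fin m) × ℂ, y ∈ coordDomain E p.1 ∧ param E p.1 y = p :=
  ⟨coords E p.1 p, coords_mem (mem_chart_source _ _) (FiberBundle.mem_baseSet_trivializationAt' _) hp,
    (param_coords (mem_chart_source _ _) (FiberBundle.mem_baseSet_trivializationAt' _)).2⟩

/-- The change of coordinates between two parametrizations. -/
theorem exists_transition [IsManifold 𝓘(ℂ, EuclideanSpace ℂ (Fin m)) ω D]
    [ContMDiffVectorBundle ω ℂ E 𝓘(ℂ, EuclideanSpace ℂ (Fin m))] {x₀ x₁ : D}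
    {y₀ y₁ : EuclideanSpace ℂ (Fin m) × ℂ} (h₀ : y₀ ∈ coordDomain E x₀)
    (h₁ : y₁ ∈ coordDomain E x₁) (h : param E x₀ y₀ = param E x₁ y₁) :
    ∃ T : EuclideanSpace ℂ (Fin m) × ℂ → EuclideanSpace ℂ (Fin m) × ℂ,
      T y₀ = y₁ ∧ ContDiffAt ℂ ∞ T y₀ ∧ ∀ᶠ y in nhds y₀, param E x₀ y = param E x₁ (T y) := by
  let c₀ := chartAt (EuclideanSpace ℂ (Fin m)) x₀
  let c₁ := chartAt (EuclideanSpace ℂ (Fin m)) x₁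
  have hfst : c₀.symm y₀.1 = c₁.symm y₁.1 := by rw [← param_fst h₀.1, h, param_fst h₁.1]
  have hs : c₀.symm y₀.1 ∈ c₁.source := by
    rw [hfst]
    exact c₁.map_target h₁.1.1
  have hb : c₀.symm y₀.1 ∈ (trivializationAt ℂ E x₁).baseSet := by
    rw [hfst]
    exact h₁.1.2
  have hc₀ : ContMDiffAt 𝓘(ℂ, EuclideanSpace ℂ (Fin m)) 𝓘(ℂ, EuclideanSpace ℂ (Fin m)) ω
      c₀.symm y₀.1 :=
    contMDiffOn_chart_symm.contMDiffAt (c₀.open_target.mem_nhds h₀.1.1)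
  have hc₁ : ContMDiffAt 𝓘(ℂ, EuclideanSpace ℂ (Fin m)) 𝓘(ℂ, EuclideanSpace ℂ (Fin m)) ω
      c₁ (c₀.symm y₀.1) :=
    contMDiffOn_chart.contMDiffAt (c₁.open_source.mem_nhds hs)
  have ht : ContDiffAt ℂ ω (fun w => c₁ (c₀.symm w)) y₀.1 :=
    (hc₁.comp y₀.1 hc₀).contDiffAt
  have hg : ContDiffAt ℂ ω (fun w => ((trivializationAt ℂ E x₀).coordChangeL ℂ
      (trivializationAt ℂ E x₁) (c₀.symm w) : ℂ →L[ℂ] ℂ)) y₀.1 :=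
    (hc₀.coordChangeL h₀.1.2 hb).contDiffAt
  have hcont : ContinuousAt (fun y : EuclideanSpace ℂ (Fin m) × ℂ => c₀.symm y.1) y₀ :=
    hc₀.continuousAt.comp continuousAt_fst
  have hev : ∀ᶠ y : EuclideanSpace ℂ (Fin m) × ℂ in nhds y₀, y.1 ∈ baseDomain E x₀ ∧
      c₀.symm y.1 ∈ c₁.source ∧ c₀.symm y.1 ∈ (trivializationAt ℂ E x₁).baseSet :=
    (((isOpen_baseDomain E x₀).preimage continuous_fst).eventually_mem h₀.1).and
      ((hcont.eventually (c₁.open_source.mem_nhds hs)).and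
        (hcont.eventually ((trivializationAt ℂ E x₁).open_baseSet.mem_nhds hb)))
  refine ⟨fun y => coords E x₁ (param E x₀ y), ?_, ?_, ?_⟩
  · simp only [h, coords_param h₁.1]
  -- Near `y₀` the transition map is the change of charts on the base together with the bundle's
  -- transition function applied to the fibre coordinate; both are holomorphic.
  · have hT : ContDiffAt ℂ ω (fun y : EuclideanSpace ℂ (Fin m) × ℂ => (c₁ (c₀.symm y.1),
        ((trivializationAt ℂ E x₀).coordChangeL ℂ
          (trivializationAt ℂ E x₁) (c₀.symm y.1) : ℂ →L[ℂ] ℂ) y.2)) y₀ :=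
      (ht.comp y₀ contDiffAt_fst).prodMk ((hg.comp y₀ contDiffAt_fst).clm_apply contDiffAt_snd)
    refine (hT.of_le le_top).congr_of_eventuallyEq ?_
    filter_upwards [hev] with y hy
    have := Bundle.Trivialization.apply_symm_apply_eq_coordChangeL (R := ℂ)
      (trivializationAt ℂ E x₀) (trivializationAt ℂ E x₁) ⟨hy.1.2, hy.2.2⟩ y.2
    have hsnd := congrArg Prod.snd this
    refine Prod.ext ?_ ?_
    · simp only [coords, param_fst hy.1]
      rfl
    · exact hsnd
  · filter_upwards [hev] with y hy
    refine ((param_coords ?_ ?_).2).symm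
    · rw [param_fst hy.1]
      exact hy.2.1
    · rw [param_fst hy.1]
      exact hy.2.2

end Coordinates

/-! ### Euler's identity for z∂_z. -/

section Euler

variable {W : Type*} [NormedAddCommGroup W] [NormedSpace ℂ W]

theorem wirt_log_norm_one : wirt (fun ζ : ℂ => ((Real.log ‖ζ‖ : ℝ) : ℂ)) 1 1 = 1 / 2 := by
  let R : ℂ →L[ℝ] ℂ := Complex.ofRealCLM.comp Complex.reCLM
  have h : (fun ζ : ℂ => ((Real.log ‖ζ‖ : ℝ) : ℂ)) = fun ζ => R (Complex.log ζ) := by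
    funext ζ
    simp [R, Complex.log_re]
  have hd : HasDerivAt Complex.log (1 : ℂ)⁻¹ 1 := Complex.hasDerivAt_log (by simp)
  rw [h, wirt_comp R.differentiableAt hd.differentiableAt, hd.hasFDerivAt.fderiv, wirt,
    ContinuousLinearMap.fderiv]
  simp [R]

/-- The operator z∂_z differentiates along the complex dilations c ↦ (w, cz) at c = 1, so a
transformation law under dilation determines it. -/
theorem wirt_vertical {f : W × ℂ → ℂ} {y : W × ℂ} (hf : DifferentiableAt ℝ f y) :
    y.2 * wirt f (0, 1) y = wirt (fun c : ℂ => f (y.1, c * y.2)) 1 1 := by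
  have hT : HasDerivAt (fun c : ℂ => (y.1, c * y.2)) ((0 : W), y.2) 1 := by
    have := (hasDerivAt_const (1 : ℂ) y.1).prodMk ((hasDerivAt_id (1 : ℂ)).mul_const y.2)
    simpa using this
  rw [wirt_comp (F := f) (T := fun c : ℂ => (y.1, c * y.2)) (by simpa using hf)
    hT.differentiableAt, hT.hasFDerivAt.fderiv, ← wirt_smul_left]
  simp

theorem wirt_vertical_of_log {f : W × ℂ → ℂ} {y : W × ℂ} (hf : DifferentiableAt ℝ f y) {a : ℂ}
    (h : ∀ c : ℂ, c ≠ 0 → f (y.1, c * y.2) = a * (Real.log ‖c‖ : ℝ) + f y) :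
    y.2 * wirt f (0, 1) y = a / 2 := by
  have hl : DifferentiableAt ℝ (fun ζ : ℂ => ((Real.log ‖ζ‖ : ℝ) : ℂ)) 1 :=
    Complex.ofRealCLM.differentiableAt.comp (1 : ℂ)
      (((contDiffAt_id (n := 1)).norm ℝ one_ne_zero).differentiableAt one_ne_zero |>.log (by simp))
  have he : (fun c : ℂ => f (y.1, c * y.2)) =ᶠ[nhds 1]
      fun c => a * (Real.log ‖c‖ : ℝ) + f y := by
    filter_upwards [isOpen_ne.mem_nhds (one_ne_zero (α := ℂ))] with c hc
    exact h c hc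
  rw [wirt_vertical hf, wirt_congr he, wirt_add (hl.const_mul a) (differentiableAt_const _),
    wirt_const_mul, wirt_const, wirt_log_norm_one]
  ring

theorem wirt_vertical_of_pow {f : W × ℂ → ℂ} {y : W × ℂ} (hf : DifferentiableAt ℝ f y) {k : ℤ}
    (h : ∀ c : ℂ, c ≠ 0 → f (y.1, c * y.2) = (‖c‖ : ℂ) ^ k * f y) :
    y.2 * wirt f (0, 1) y = k / 2 * f y := by
  have hl : DifferentiableAt ℝ (fun ζ : ℂ => ((Real.log ‖ζ‖ : ℝ) : ℂ)) 1 :=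
    Complex.ofRealCLM.differentiableAt.comp (1 : ℂ)
      (((contDiffAt_id (n := 1)).norm ℝ one_ne_zero).differentiableAt one_ne_zero |>.log (by simp))
  have he : (fun c : ℂ => f (y.1, c * y.2)) =ᶠ[nhds 1]
      fun c => f y * Complex.exp (k * ((Real.log ‖c‖ : ℝ) : ℂ)) := by
    filter_upwards [isOpen_ne.mem_nhds (one_ne_zero (α := ℂ))] with c hc
    rw [h c hc, Complex.exp_int_mul, ← Complex.ofReal_exp, Real.exp_log (norm_pos_iff.2 hc)]
    ring
  rw [wirt_vertical hf, wirt_congr he, wirt_const_mul, wirt_exp (hl.const_mul _), wirt_const_mul,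
    wirt_log_norm_one]
  simp
  ring

theorem wirtBar_snd (w y : W × ℂ) : wirtBar (fun y' : W × ℂ => y'.2) w y = 0 := by
  have : fderiv ℝ (fun y' : W × ℂ => y'.2) y = ContinuousLinearMap.snd ℝ W ℂ := fderiv_snd
  rw [wirtBar, this]
  simp [← mul_assoc]

/-- The coordinate z is holomorphic, so multiplication by it commutes with ∂̄, and ∂̄ commutes with
∂. Hence g is a ∂̄-potential for the contraction of ∂∂̄f with z∂_z. -/
theorem mul_levi_vertical {f g : W × ℂ → ℂ} {y : W × ℂ} (hf : ContDiffAt ℝ 2 f y)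
    (h : ∀ᶠ y' in nhds y, y'.2 * wirt f (0, 1) y' = g y') (w : W × ℂ) :
    y.2 * levi f (0, 1) w y = wirtBar g w y := by
  have he : g =ᶠ[nhds y] fun y' => y'.2 * wirt f (0, 1) y' := h.mono fun y' hy' => hy'.symm
  rw [wirtBar_congr he, wirtBar_mul differentiableAt_snd (hasFDerivAt_wirt hf _).differentiableAt,
    wirtBar_snd, levi_eq_wirtBar_wirt hf]
  ring

end Euler

/-! ### The standard coordinate functionals. -/

section Coordinates

/-- The coordinate functionals on `ℂᵐ × ℂ`. -/
def coordL (m : ℕ) : EuclideanSpace ℂ (Fin m) × ℂ →L[ℂ] (Fin m ⊕ Unit → ℂ) :=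
  ContinuousLinearMap.pi (Sum.elim
    (fun a => (EuclideanSpace.proj a).comp (ContinuousLinearMap.fst ℂ _ _))
    (fun _ => ContinuousLinearMap.snd ℂ _ _))

theorem euclidean_eq_sum {m : ℕ} (v : EuclideanSpace ℂ (Fin m)) :
    v = ∑ a, v a • baseVec m a := by
  ext a
  simp [baseVec, Pi.single_apply]

theorem eq_sum_coordVec {m : ℕ} (v : EuclideanSpace ℂ (Fin m) × ℂ) :
    v = ∑ i, coordL m v i • coordVec m i := by
  rw [Fintype.sum_sum_type]
  refine Prod.ext ?_ ?_
  · conv_lhs => rw [euclidean_eq_sum v.1]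
    simp [coordL, coordVec, Prod.fst_sum]
  · simp [coordL, coordVec, Prod.snd_sum]

theorem coordL_coordVec {m : ℕ} (i j : Fin m ⊕ Unit) :
    coordL m (coordVec m i) j = if i = j then 1 else 0 := by
  rcases i with i | i <;> rcases j with j | j <;>
    simp [coordL, coordVec, baseVec, eq_comm]

end Coordinates

/-! ### The Hermitian metric and the positivity of ω₀. -/

section Metric

variable {m : ℕ} {D : Type*} [TopologicalSpace D] [ChartedSpace (EuclideanSpace ℂ (Fin m)) D]
  {E : D → Type*} [∀ x, AddCommGroup (E x)] [∀ x, Module ℂ (E x)]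
  [TopologicalSpace (Bundle.TotalSpace ℂ E)] [∀ x, TopologicalSpace (E x)]
  [FiberBundle ℂ E] [VectorBundle ℂ ℂ E] (h : HermitianMetric (m := m) E)

theorem HermitianMetric.normSq_fibreSmul (c : ℂ) (p : Bundle.TotalSpace ℂ E) :
    h.normSq (fibreSmul c p) = ‖c‖ ^ 2 * h.normSq p := by
  change (h.inner p.1 (c • p.2) (c • p.2)).re = ‖c‖ ^ 2 * (h.inner p.1 p.2 p.2).re
  rw [map_smulₛₗ, map_smulₛₗ, LinearMap.smul_apply, RingHom.id_apply, smul_eq_mul, smul_eq_mul]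
  rw [← mul_assoc, Complex.mul_conj, Complex.re_ofReal_mul,
    Complex.normSq_eq_norm_sq]

theorem HermitianMetric.normSq_pos {p : Bundle.TotalSpace ℂ E} (hp : p ∈ puncturedTotal E) :
    0 < h.normSq p :=
  h.pos p.1 p.2 hp

/-- The squared norm of the local holomorphic frame around `x₀`. -/
def HermitianMetric.frameNormSq (x₀ : D) (w : EuclideanSpace ℂ (Fin m)) : ℝ :=
  h.normSq (param E x₀ (w, 1))

theorem HermitianMetric.frameNormSq_pos {x₀ : D} {w : EuclideanSpace ℂ (Fin m)}
    (hw : w ∈ baseDomain E x₀) : 0 < h.frameNormSq x₀ w :=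
  h.normSq_pos (param_mem ⟨hw, one_ne_zero⟩)

theorem HermitianMetric.normSq_param {x₀ : D} {y : EuclideanSpace ℂ (Fin m) × ℂ}
    (hy : y.1 ∈ baseDomain E x₀) :
    h.normSq (param E x₀ y) = ‖y.2‖ ^ 2 * h.frameNormSq x₀ y.1 := by
  rw [param_eq_fibreSmul hy, h.normSq_fibreSmul]
  rfl

theorem HermitianMetric.contDiffAt_frameNormSq {x₀ : D} {w : EuclideanSpace ℂ (Fin m)}
    (hw : w ∈ baseDomain E x₀) : ContDiffAt ℝ ∞ (h.frameNormSq x₀) w :=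
  (h.smooth x₀).contDiffAt ((isOpen_baseDomain E x₀).mem_nhds hw)

theorem contDiffAt_ofReal {X : Type*} [NormedAddCommGroup X] [NormedSpace ℝ X] {f : X → ℝ} {x : X}
    (hf : ContDiffAt ℝ ∞ f x) : ContDiffAt ℝ ∞ (fun y => (f y : ℂ)) x :=
  Complex.ofRealCLM.contDiff.contDiffAt.comp x hf

theorem contDiffAt_of_ofReal {X : Type*} [NormedAddCommGroup X] [NormedSpace ℝ X] {f : X → ℝ}
    {x : X} (hf : ContDiffAt ℝ ∞ (fun y => (f y : ℂ)) x) : ContDiffAt ℝ ∞ f x :=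
  Complex.reCLM.contDiff.contDiffAt.comp x hf

/-- The logarithm of the squared norm in the coordinates around `x₀`. -/
def HermitianMetric.logNormSq (x₀ : D) (y : EuclideanSpace ℂ (Fin m) × ℂ) : ℝ :=
  Real.log (h.normSq (param E x₀ y))

theorem HermitianMetric.contDiffAt_log_frameNormSq {x₀ : D} {w : EuclideanSpace ℂ (Fin m)}
    (hw : w ∈ baseDomain E x₀) :
    ContDiffAt ℝ ∞ (fun w' => ((Real.log (h.frameNormSq x₀ w') : ℝ) : ℂ)) w :=
  contDiffAt_ofReal ((h.contDiffAt_frameNormSq hw).log (h.frameNormSq_pos hw).ne')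

theorem contDiffAt_log_norm_snd {y : EuclideanSpace ℂ (Fin m) × ℂ} (hy : y.2 ≠ 0) :
    ContDiffAt ℝ ∞ (fun y' : EuclideanSpace ℂ (Fin m) × ℂ => ((Real.log ‖y'.2‖ : ℝ) : ℂ)) y :=
  contDiffAt_ofReal ((contDiffAt_snd.norm ℝ hy).log (by simpa using hy))

theorem HermitianMetric.logNormSq_eventuallyEq {x₀ : D} {y : EuclideanSpace ℂ (Fin m) × ℂ}
    (hy : y ∈ coordDomain E x₀) : (fun y' => (h.logNormSq x₀ y' : ℂ)) =ᶠ[nhds y] fun y' =>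
      2 * ((Real.log ‖y'.2‖ : ℝ) : ℂ) + ((Real.log (h.frameNormSq x₀ y'.1) : ℝ) : ℂ) := by
  filter_upwards [(isOpen_coordDomain E x₀).mem_nhds hy] with y' hy'
  rw [logNormSq, h.normSq_param hy'.1, Real.log_mul (by simpa using hy'.2)
    (h.frameNormSq_pos hy'.1).ne', Real.log_pow]
  push_cast
  ring

theorem HermitianMetric.contDiffAt_logNormSq {x₀ : D} {y : EuclideanSpace ℂ (Fin m) × ℂ}
    (hy : y ∈ coordDomain E x₀) : ContDiffAt ℝ ∞ (fun y' => (h.logNormSq x₀ y' : ℂ)) y := by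
  refine ContDiffAt.congr_of_eventuallyEq ?_ (h.logNormSq_eventuallyEq hy)
  exact (contDiffAt_const.mul (contDiffAt_log_norm_snd hy.2)).add
    ((h.contDiffAt_log_frameNormSq hy.1).comp y contDiffAt_fst)

/-- In log|S|² = 2 log|z| + log|σ|² the first term is pluriharmonic off the zero section, so √-1 ∂∂̄
log|S|² is the pullback of -ω_D. -/
theorem HermitianMetric.levi_logNormSq {x₀ : D} {y : EuclideanSpace ℂ (Fin m) × ℂ}
    (hy : y ∈ coordDomain E x₀) (v w : EuclideanSpace ℂ (Fin m) × ℂ) :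
    levi (fun y' => (h.logNormSq x₀ y' : ℂ)) v w y =
      levi (fun w' => ((Real.log (h.frameNormSq x₀ w') : ℝ) : ℂ)) v.1 w.1 y.1 := by
  have h1 := contDiffAt_log_norm_snd hy.2
  have h2 := h.contDiffAt_log_frameNormSq hy.1
  have h3 : ContDiffAt ℝ 2 (fun y' : EuclideanSpace ℂ (Fin m) × ℂ =>
      ((Real.log (h.frameNormSq x₀ y'.1) : ℝ) : ℂ)) y :=
    (contDiffAt_two h2).comp y contDiffAt_fst
  rw [levi_congr (h.logNormSq_eventuallyEq hy),
    levi_add (contDiffAt_const.mul (contDiffAt_two h1)) h3, levi_const_mul,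
    levi_log_norm contDiffAt_snd hy.2, mul_zero, zero_add,
    levi_comp (F := fun w' => ((Real.log (h.frameNormSq x₀ w') : ℝ) : ℂ)) (contDiffAt_two h2)
      contDiffAt_fst, fderiv_fst]
  rfl

theorem HermitianMetric.wirt_logNormSq_vertical {x₀ : D} {y : EuclideanSpace ℂ (Fin m) × ℂ}
    (hy : y ∈ coordDomain E x₀) :
    y.2 * wirt (fun y' => (h.logNormSq x₀ y' : ℂ)) (0, 1) y = 1 := by
  rw [wirt_vertical_of_log (a := 2)
    (differentiableAt_of_two (contDiffAt_two (h.contDiffAt_logNormSq hy))) fun c hc => ?_]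
  · norm_num
  · rw [logNormSq, param_mul hy.1, h.normSq_fibreSmul,
      Real.log_mul (by simpa using hc) (h.normSq_pos (param_mem hy)).ne', Real.log_pow, logNormSq]
    push_cast
    ring

variable {h}

theorem HermitianMetric.IsPositive.levi_neg (hpos : h.IsPositive) {x₀ : D}
    {w : EuclideanSpace ℂ (Fin m)} (hw : w ∈ baseDomain E x₀) {v : EuclideanSpace ℂ (Fin m)}
    (hv : v ≠ 0) :
    (levi (fun w' => ((Real.log (h.frameNormSq x₀ w') : ℝ) : ℂ)) v v w).re < 0 := by
  -- `levi` is linear in its first vector, whereas the quadratic form of a matrix conjugates its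
  -- left factor; hence the conjugate of `v`.
  have hx : (fun a => starRingEnd ℂ (v a)) ≠ 0 := by
    intro h0
    apply hv
    ext a
    simpa using congrFun h0 a
  have key := (hpos x₀ w hw).dotProduct_mulVec_pos hx
  have he : star (fun a => starRingEnd ℂ (v a)) ⬝ᵥ
      (h.curvature x₀ w).mulVec (fun a => starRingEnd ℂ (v a)) =
      -levi (fun w' => ((Real.log (h.frameNormSq x₀ w') : ℝ) : ℂ)) v v w := by
    rw [euclidean_eq_sum v, levi_sum (contDiffAt_two (h.contDiffAt_log_frameNormSq hw)),
      ← euclidean_eq_sum v]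
    simp only [dotProduct, Matrix.mulVec, Finset.mul_sum, ← Finset.sum_neg_distrib]
    refine Finset.sum_congr rfl fun i _ => Finset.sum_congr rfl fun j _ => ?_
    simp only [curvature, Matrix.neg_apply, ddbar_apply, Pi.star_apply, RCLike.star_def,
      Complex.conj_conj]
    simp only [frameNormSq]
    ring
  rw [he] at key
  have := (Complex.pos_iff.1 key).1
  simpa using this

/-- The function `|S|⁻²` in the coordinates around `x₀`. -/
def HermitianMetric.invNormSq (h : HermitianMetric (m := m) E) (x₀ : D)
    (y : EuclideanSpace ℂ (Fin m) × ℂ) : ℝ :=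
  (h.normSq (param E x₀ y))⁻¹

theorem HermitianMetric.formalForm_eq (u : ℕ → Bundle.TotalSpace ℂ E → ℝ) (x₀ : D) :
    h.formalForm u x₀ =
      localForm (coordVec m) (h.invNormSq x₀) (fun k y => u k (param E x₀ y)) := by
  have : h.omegaZero x₀ = ddbar (coordVec m) fun y => (h.invNormSq x₀ y : ℂ) := by
    funext y
    simp only [omegaZero, invNormSq, Complex.ofReal_inv]
  funext k y
  simp only [formalForm, localForm, this]

variable (h) in
theorem HermitianMetric.invNormSq_eventuallyEq {x₀ : D} {y : EuclideanSpace ℂ (Fin m) × ℂ}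
    (hy : y ∈ coordDomain E x₀) : (fun y' => (h.invNormSq x₀ y' : ℂ)) =ᶠ[nhds y] fun y' =>
      Complex.exp (-1 * (h.logNormSq x₀ y' : ℂ)) := by
  filter_upwards [(isOpen_coordDomain E x₀).mem_nhds hy] with y' hy'
  rw [logNormSq, invNormSq, neg_one_mul, Complex.exp_neg, ← Complex.ofReal_exp,
    Real.exp_log (h.normSq_pos (param_mem hy')), Complex.ofReal_inv]

variable (h) in
theorem HermitianMetric.contDiffAt_invNormSq {x₀ : D} {y : EuclideanSpace ℂ (Fin m) × ℂ}
    (hy : y ∈ coordDomain E x₀) : ContDiffAt ℝ ∞ (fun y' => (h.invNormSq x₀ y' : ℂ)) y :=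
  (contDiffAt_const.mul (h.contDiffAt_logNormSq hy)).cexp.congr_of_eventuallyEq
    (h.invNormSq_eventuallyEq hy)

/-- With φ = log|S|², ∂∂̄ e^(-φ) = e^(-φ) (-∂∂̄φ + ∂φ ∧ ∂̄φ). The first term is positive unless `v`
is vertical, and on nonzero vertical vectors the second is, because z∂_z φ = 1. -/
theorem HermitianMetric.IsPositive.levi_invNormSq_pos (hpos : h.IsPositive) {x₀ : D}
    {y : EuclideanSpace ℂ (Fin m) × ℂ} (hy : y ∈ coordDomain E x₀)
    {v : EuclideanSpace ℂ (Fin m) × ℂ} (hv : v ≠ 0) :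
    0 < (levi (fun y' => (h.invNormSq x₀ y' : ℂ)) v v y).re := by
  have hφ := contDiffAt_two (h.contDiffAt_logNormSq hy)
  rw [levi_congr (h.invNormSq_eventuallyEq hy), levi_exp (contDiffAt_const.mul hφ),
    levi_const_mul, wirt_const_mul, wirtBar_const_mul, ← (h.invNormSq_eventuallyEq hy).eq_of_nhds,
    Complex.re_ofReal_mul, h.levi_logNormSq hy, wirtBar_ofReal]
  refine mul_pos (inv_pos.2 (h.normSq_pos (param_mem hy))) ?_
  set q := wirt (fun y' => (h.logNormSq x₀ y' : ℂ)) v y with hq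
  have e : (-1 * levi (fun w' => ((Real.log (h.frameNormSq x₀ w') : ℝ) : ℂ)) v.1 v.1 y.1 +
      -1 * q * (-1 * starRingEnd ℂ q)).re =
      -(levi (fun w' => ((Real.log (h.frameNormSq x₀ w') : ℝ) : ℂ)) v.1 v.1 y.1).re +
        ‖q‖ ^ 2 := by
    rw [show -1 * q * (-1 * starRingEnd ℂ q) = q * starRingEnd ℂ q by ring, Complex.mul_conj,
      Complex.normSq_eq_norm_sq]
    rw [neg_one_mul, Complex.add_re, Complex.neg_re, Complex.ofReal_re]
  rw [e]
  by_cases h1 : v.1 = 0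
  · have h2 : v.2 ≠ 0 := fun h2 => hv (Prod.ext h1 h2)
    have hv' : v = v.2 • ((0 : EuclideanSpace ℂ (Fin m)), (1 : ℂ)) := by
      ext <;> simp [h1]
    have hq0 : q ≠ 0 := by
      rw [hq, hv', wirt_smul_left]
      exact mul_ne_zero h2 (right_ne_zero_of_mul_eq_one (h.wirt_logNormSq_vertical hy))
    rw [h1, levi_zero_left]
    have := norm_pos_iff.2 hq0
    simp only [Complex.zero_re, neg_zero, zero_add]
    positivity
  · have := hpos.levi_neg hy.1 h1
    nlinarith [sq_nonneg ‖q‖]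

theorem HermitianMetric.IsPositive.posDef (hpos : h.IsPositive) {x₀ : D}
    {y : EuclideanSpace ℂ (Fin m) × ℂ} (hy : y ∈ coordDomain E x₀) :
    (ddbar (coordVec m) (fun y' => (h.invNormSq x₀ y' : ℂ)) y).PosDef := by
  have hc := contDiffAt_two (h.contDiffAt_invNormSq hy)
  refine Matrix.PosDef.of_dotProduct_mulVec_pos (isHermitian_ddbar hc) fun {x} hx => ?_
  set v := ∑ i, starRingEnd ℂ (x i) • coordVec m i with hv
  have hcv : ∀ j, coordL m v j = starRingEnd ℂ (x j) := fun j => by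
    rw [hv, map_sum, Finset.sum_apply]
    simp [coordL_coordVec]
  have hv0 : v ≠ 0 := by
    intro h0
    apply hx
    funext j
    have := hcv j
    rw [h0, map_zero] at this
    simpa using this.symm
  have he : star x ⬝ᵥ
      (ddbar (coordVec m) (fun y' => (h.invNormSq x₀ y' : ℂ)) y).mulVec x =
      levi (fun y' => (h.invNormSq x₀ y' : ℂ)) v v y := by
    rw [hv, levi_sum hc]
    simp only [dotProduct, Matrix.mulVec, Finset.mul_sum]
    refine Finset.sum_congr rfl fun i _ => Finset.sum_congr rfl fun j _ => ?_
    simp only [ddbar_apply, Pi.star_apply, RCLike.star_def, Complex.conj_conj]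
    ring
  rw [he, Complex.pos_iff]
  refine ⟨hpos.levi_invNormSq_pos hy hv0, ?_⟩
  exact (Complex.conj_eq_iff_im.1 (levi_ofReal_symm hc v v)).symm

theorem SmoothOff.contDiffAt {f : Bundle.TotalSpace ℂ E → ℝ} (hf : SmoothOff m f) {x₀ : D}
    {y : EuclideanSpace ℂ (Fin m) × ℂ} (hy : y ∈ coordDomain E x₀) :
    ContDiffAt ℝ ∞ (fun y' => (f (param E x₀ y') : ℂ)) y :=
  contDiffAt_ofReal ((hf x₀).contDiffAt ((isOpen_coordDomain E x₀).mem_nhds hy))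

theorem HermitianMetric.IsPositive.isAdmissible (hpos : h.IsPositive)
    {u : ℕ → Bundle.TotalSpace ℂ E → ℝ} (hu : ∀ k, 0 < k → SmoothOff m (u k)) (x₀ : D) :
    IsAdmissible (coordVec m) (h.invNormSq x₀) (fun k y => u k (param E x₀ y))
      (coordDomain E x₀) where
  isOpen := isOpen_coordDomain E x₀
  smooth _ hy := h.contDiffAt_invNormSq hy
  smooth_pot k hk _ hy := (hu k hk).contDiffAt hy
  pos _ hy := hpos.posDef hy

end Metric

/-! ### Weights, dilations of the fibres and the Lie derivative. -/

section Homogeneous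

variable {m : ℕ} {D : Type*} [TopologicalSpace D] [ChartedSpace (EuclideanSpace ℂ (Fin m)) D]
  {E : D → Type*} [∀ x, AddCommGroup (E x)] [∀ x, Module ℂ (E x)]
  [TopologicalSpace (Bundle.TotalSpace ℂ E)] [∀ x, TopologicalSpace (E x)]
  [FiberBundle ℂ E] [VectorBundle ℂ ℂ E] {h : HermitianMetric (m := m) E}

theorem fibreSmul_fibreSmul (a c : ℂ) (p : Bundle.TotalSpace ℂ E) :
    fibreSmul a (fibreSmul c p) = fibreSmul (a * c) p :=
  congrArg (Bundle.TotalSpace.mk p.1) (smul_smul a c p.2)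

theorem exp_zpow (t : ℝ) (k : ℤ) : Real.exp t ^ k = Real.exp (k * t) := by
  rw [← Real.rpow_intCast, ← Real.exp_mul, mul_comm]

/-- Dilation of the fibre coordinate. -/
def dilate (m : ℕ) (c : ℂ) (y : EuclideanSpace ℂ (Fin m) × ℂ) : EuclideanSpace ℂ (Fin m) × ℂ :=
  (y.1, c * y.2)

theorem dilate_mem {c : ℂ} (hc : c ≠ 0) {x₀ : D} {y : EuclideanSpace ℂ (Fin m) × ℂ}
    (hy : y ∈ coordDomain E x₀) : dilate m c y ∈ coordDomain E x₀ :=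
  ⟨hy.1, mul_ne_zero hc hy.2⟩

theorem param_dilate (c : ℂ) {x₀ : D} {y : EuclideanSpace ℂ (Fin m) × ℂ}
    (hy : y ∈ coordDomain E x₀) : param E x₀ (dilate m c y) = fibreSmul c (param E x₀ y) :=
  param_mul hy.1 c

theorem contDiff_dilate (m : ℕ) (c : ℂ) : ContDiff ℂ ∞ (dilate m c) :=
  contDiff_fst.prodMk (contDiff_const.mul contDiff_snd)

/-- The diagonal of the Jacobian matrix of `dilate m c`. -/
def dilateDiag (m : ℕ) (c : ℂ) : Fin m ⊕ Unit → ℂ := Sum.elim (fun _ => 1) (fun _ => c)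

theorem jacobian_dilate (c : ℂ) (y : EuclideanSpace ℂ (Fin m) × ℂ) :
    jacobian (coordVec m) (coordL m) (dilate m c) y = Matrix.diagonal (dilateDiag m c) := by
  have hT : HasFDerivAt (dilate m c)
      ((ContinuousLinearMap.fst ℂ (EuclideanSpace ℂ (Fin m)) ℂ).prod
        (c • ContinuousLinearMap.snd ℂ (EuclideanSpace ℂ (Fin m)) ℂ)) y :=
    hasFDerivAt_fst.prodMk (hasFDerivAt_snd.const_mul c)
  ext k i
  have hv : fderiv ℂ (dilate m c) y (coordVec m i) = dilateDiag m c i • coordVec m i := by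
    rw [hT.fderiv]
    rcases i with i | i <;> simp [coordVec, dilateDiag]
  rw [jacobian, Matrix.of_apply, hv, map_smul, Pi.smul_apply, coordL_coordVec, Matrix.diagonal_apply]
  by_cases hik : i = k
  · simp [hik]
  · simp [hik, Ne.symm hik]

theorem HermitianMetric.invNormSq_dilate {c : ℂ} {x₀ : D}
    {y : EuclideanSpace ℂ (Fin m) × ℂ} (hy : y ∈ coordDomain E x₀) :
    h.invNormSq x₀ (dilate m c y) = ‖c‖ ^ (-2 : ℤ) * h.invNormSq x₀ y := by
  rw [invNormSq, param_dilate c hy, h.normSq_fibreSmul, invNormSq, mul_inv, zpow_neg]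
  rfl

theorem HermitianMetric.invNormSq_dilate' {c : ℂ} (hc : c ≠ 0) {x₀ : D}
    {y : EuclideanSpace ℂ (Fin m) × ℂ} (hy : y ∈ coordDomain E x₀) :
    h.invNormSq x₀ y = ‖c‖⁻¹ ^ (-2 : ℤ) * h.invNormSq x₀ (dilate m c y) := by
  have := norm_pos_iff.2 hc
  rw [h.invNormSq_dilate hy, ← mul_assoc, ← mul_zpow, inv_mul_cancel₀ this.ne', one_zpow, one_mul]

/-- `f` has weight `k` for the fibrewise multiplication by `c`. -/
def ScalesBy (c : ℂ) (k : ℤ) (f : Bundle.TotalSpace ℂ E → ℝ) : Prop :=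
  ∀ p ∈ puncturedTotal E, f (fibreSmul c p) = ‖c‖ ^ k * f p

theorem ScalesBy.param_dilate {c : ℂ} {k : ℤ} {f : Bundle.TotalSpace ℂ E → ℝ}
    (hf : ScalesBy c k f) {x₀ : D} {y : EuclideanSpace ℂ (Fin m) × ℂ}
    (hy : y ∈ coordDomain E x₀) :
    f (param E x₀ (dilate m c y)) = ‖c‖ ^ k * f (param E x₀ y) := by
  rw [ExpandingSoliton.param_dilate c hy, hf _ (param_mem hy)]

theorem ScalesBy.param_dilate' {c : ℂ} (hc : c ≠ 0) {k : ℕ} {f : Bundle.TotalSpace ℂ E → ℝ}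
    (hf : ScalesBy c k f) {x₀ : D} {y : EuclideanSpace ℂ (Fin m) × ℂ}
    (hy : y ∈ coordDomain E x₀) :
    f (param E x₀ y) = ‖c‖⁻¹ ^ k * f (param E x₀ (dilate m c y)) := by
  have := norm_pos_iff.2 hc
  rw [hf.param_dilate hy, ← mul_assoc, zpow_natCast, ← mul_pow, inv_mul_cancel₀ this.ne', one_pow,
    one_mul]

variable {u : ℕ → Bundle.TotalSpace ℂ E → ℝ}

/-- The case of `localForm_comp` in which both families are the same and `T` is a dilation; the
Jacobian is then diagonal. -/
theorem HermitianMetric.IsPositive.localForm_dilate (hpos : h.IsPositive)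
    (hu : ∀ k : ℕ, 0 < k → SmoothOff m (u k)) {c : ℂ} (hc : c ≠ 0)
    (hs : ∀ k : ℕ, 0 < k → ScalesBy c k (u k)) {x₀ : D} {y : EuclideanSpace ℂ (Fin m) × ℂ}
    (hy : y ∈ coordDomain E x₀) (k : ℤ) (i j : Fin m ⊕ Unit) :
    dilateDiag m c i * localForm (coordVec m) (h.invNormSq x₀) (fun k y => u k (param E x₀ y)) k
        (dilate m c y) i j * starRingEnd ℂ (dilateDiag m c j) =
      (‖c‖ : ℂ) ^ k * localForm (coordVec m) (h.invNormSq x₀)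
        (fun k y => u k (param E x₀ y)) k y i j := by
  have hA := hpos.isAdmissible hu x₀
  have hev := (isOpen_coordDomain E x₀).eventually_mem hy
  have := localForm_comp (a := ‖c‖⁻¹) hA hA eq_sum_coordVec hy (dilate_mem hc hy)
    (contDiff_dilate m c).contDiffAt (hev.mono fun y' hy' => h.invNormSq_dilate' hc hy')
    (fun k hk => hev.mono fun y' hy' => (hs k hk).param_dilate' hc hy') k
  have hc' : (‖c‖ : ℂ) ≠ 0 := by simpa using hc
  rw [this, jacobian_dilate, Matrix.diagonal_transpose, Matrix.diagonal_map (by simp),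
    Matrix.smul_apply, Matrix.mul_diagonal, Matrix.diagonal_mul, smul_eq_mul, ← mul_assoc,
    ← mul_zpow, Complex.ofReal_inv, mul_inv_cancel₀ hc', one_zpow, one_mul]

theorem HermitianMetric.IsPositive.logDetCoeff_dilate (hpos : h.IsPositive)
    (hu : ∀ k : ℕ, 0 < k → SmoothOff m (u k)) {c : ℂ} (hc : c ≠ 0)
    (hs : ∀ k : ℕ, 0 < k → ScalesBy c k (u k)) {x₀ : D} {y : EuclideanSpace ℂ (Fin m) × ℂ}
    (hy : y ∈ coordDomain E x₀) (n : ℕ) :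
    logDetCoeff (coordVec m) (h.invNormSq x₀) (fun k y => u k (param E x₀ y)) n (dilate m c y) =
      (‖c‖ : ℂ) ^ n *
        logDetCoeff (coordVec m) (h.invNormSq x₀) (fun k y => u k (param E x₀ y)) n y := by
  have hA := hpos.isAdmissible hu x₀
  have hev := (isOpen_coordDomain E x₀).eventually_mem hy
  have hc' : ‖c‖ ≠ 0 := by simpa using hc
  have := logDetCoeff_comp (a := ‖c‖⁻¹) hA hA eq_sum_coordVec hy (dilate_mem hc hy)
    (contDiff_dilate m c).contDiffAt (inv_ne_zero hc')
    (hev.mono fun y' hy' => h.invNormSq_dilate' hc hy')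
    (fun k hk => hev.mono fun y' hy' => (hs k hk).param_dilate' hc hy') n
  rw [this, ← mul_assoc, ← mul_pow, Complex.ofReal_inv,
    mul_inv_cancel₀ (by exact_mod_cast hc'), one_pow, one_mul]

/-- The weight -2 of ω₀ contributes -2(m + 1) to the exponent of |c|, and the Jacobian of the
dilation contributes -2. -/
theorem HermitianMetric.IsPositive.logNormDet_dilate (hpos : h.IsPositive) {c : ℂ} (hc : c ≠ 0)
    {x₀ : D} {y : EuclideanSpace ℂ (Fin m) × ℂ} (hy : y ∈ coordDomain E x₀) :
    logNormDet (coordVec m) (h.invNormSq x₀) (dilate m c y) =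
      -(2 * m + 4) * Real.log ‖c‖ + logNormDet (coordVec m) (h.invNormSq x₀) y := by
  have hu : ∀ k : ℕ, 0 < k → SmoothOff m (fun _ : Bundle.TotalSpace ℂ E => (0 : ℝ)) :=
    fun _ _ _ => contDiffOn_const
  have hA := hpos.isAdmissible hu x₀
  set G := fun y => ddbar (coordVec m) (fun y' => (h.invNormSq x₀ y' : ℂ)) y with hG
  have hM : Matrix.diagonal (dilateDiag m c) * G (dilate m c y) *
      Matrix.diagonal (fun j => starRingEnd ℂ (dilateDiag m c j)) = ((‖c‖ : ℂ) ^ (-2 : ℤ)) • G y := by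
    ext i j
    have := hpos.localForm_dilate hu hc (fun k _ p _ => by simp) hy (-2) i j
    rw [localForm_neg_two, localForm_neg_two] at this
    rw [Matrix.mul_diagonal, Matrix.diagonal_mul, Matrix.smul_apply, smul_eq_mul, ← this]
  have hdet := congrArg (fun M => ‖M.det‖) hM
  have hcard : Fintype.card (Fin m ⊕ Unit) = m + 1 := by simp
  simp only [Matrix.det_mul, Matrix.det_diagonal, Matrix.det_smul, norm_mul, norm_pow, hcard,
    Fintype.prod_sum_type, dilateDiag, Sum.elim_inl, Sum.elim_inr, map_one, Finset.prod_const_one,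
    Finset.univ_unique, Finset.prod_singleton, one_mul, RCLike.norm_conj, norm_zpow,
    Complex.norm_real, norm_norm] at hdet
  have h1 : ‖(G (dilate m c y)).det‖ ≠ 0 := norm_ne_zero_iff.2 (hA.det_ne_zero (dilate_mem hc hy))
  have h2 : ‖(G y).det‖ ≠ 0 := norm_ne_zero_iff.2 (hA.det_ne_zero hy)
  have h3 : ‖c‖ ≠ 0 := norm_ne_zero_iff.2 hc
  have hlog := congrArg Real.log hdet
  rw [Real.log_mul (mul_ne_zero h3 h1) h3, Real.log_mul h3 h1, Real.log_mul (by positivity) h2,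
    Real.log_pow, Real.log_zpow] at hlog
  simp only [logNormDet]
  push_cast at hlog
  linarith

theorem HermitianMetric.IsPositive.lieForm_formalForm (hpos : h.IsPositive)
    (hu : ∀ k : ℕ, 0 < k → SmoothOff m (u k))
    (hs : ∀ t : ℝ, ∀ k : ℕ, 0 < k → ScalesBy (Real.exp t : ℂ) k (u k)) {x₀ : D}
    {y : EuclideanSpace ℂ (Fin m) × ℂ} (hy : y ∈ coordDomain E x₀) (k : ℤ) :
    lieForm (h.formalForm u x₀ k) y = (k : ℂ) • h.formalForm u x₀ k y := by
  rw [h.formalForm_eq]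
  ext i j
  rw [lieForm, Matrix.of_apply, Matrix.smul_apply, smul_eq_mul]
  have he : ∀ t : ℝ, (Sum.elim (fun _ => 1) (fun _ => (Real.exp t : ℂ)) i : ℂ) *
      localForm (coordVec m) (h.invNormSq x₀) (fun k y => u k (param E x₀ y)) k
        (y.1, (Real.exp t : ℂ) * y.2) i j *
      (Sum.elim (fun _ => 1) (fun _ => (Real.exp t : ℂ)) j : ℂ) =
      Complex.exp ((k : ℂ) * t) * localForm (coordVec m) (h.invNormSq x₀)
        (fun k y => u k (param E x₀ y)) k y i j := by
    intro t
    have h0 : (Real.exp t : ℂ) ≠ 0 := by exact_mod_cast (Real.exp_pos t).ne'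
    have := hpos.localForm_dilate hu h0 (hs t) hy k i j
    have hconj : starRingEnd ℂ (dilateDiag m (Real.exp t : ℂ) j) =
        dilateDiag m (Real.exp t : ℂ) j := by
      rcases j with j | j
      · simp [dilateDiag]
      · exact Complex.conj_ofReal _
    rw [hconj, Complex.norm_real, Real.norm_eq_abs, abs_of_pos (Real.exp_pos t),
      Complex.ofReal_exp, ← Complex.exp_int_mul] at this
    rw [← this, Complex.ofReal_exp]
    rfl
  rw [funext he]
  have hd : HasDerivAt (fun t : ℝ => Complex.exp ((k : ℂ) * t) *
      localForm (coordVec m) (h.invNormSq x₀) (fun k y => u k (param E x₀ y)) k y i j)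
      ((k : ℂ) * localForm (coordVec m) (h.invNormSq x₀)
        (fun k y => u k (param E x₀ y)) k y i j) 0 := by
    have h1 : HasDerivAt (fun t : ℝ => (k : ℂ) * (t : ℂ)) (k : ℂ) 0 := by
      simpa using (Complex.ofRealCLM.hasDerivAt (x := (0 : ℝ))).const_mul (k : ℂ)
    simpa using h1.cexp.mul_const (localForm (coordVec m) (h.invNormSq x₀)
        (fun k y => u k (param E x₀ y)) k y i j)
  exact hd.deriv

theorem hasWeight_of_scalesBy {k : ℤ} {f : Bundle.TotalSpace ℂ E → ℝ} (hf : SmoothOff m f)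
    (hs : ∀ t : ℝ, ScalesBy (Real.exp t : ℂ) k f) : HasWeight m k f := by
  refine ⟨hf, fun p hp => ?_⟩
  have he : ∀ t : ℝ, f ⟨p.1, (Real.exp t : ℂ) • p.2⟩ = Real.exp ((k : ℝ) * t) * f p := by
    intro t
    have := hs t p hp
    rw [Complex.norm_real, Real.norm_eq_abs, abs_of_pos (Real.exp_pos t), exp_zpow]
      at this
    exact this
  rw [lieFun, funext he]
  have h1 : HasDerivAt (fun t : ℝ => (k : ℝ) * t) k 0 := by
    simpa using (hasDerivAt_id (0 : ℝ)).const_mul (k : ℝ)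
  simpa using (h1.exp.mul_const (f p)).deriv

/-- Along an orbit of the flow f satisfies f' = kf, so e^(-kt) f is constant. Only positive
dilations are reached: the weight condition says nothing about rotations of the fibre. -/
theorem scalesBy_of_hasWeight {k : ℤ} {f : Bundle.TotalSpace ℂ E → ℝ} (hf : HasWeight m k f)
    (t : ℝ) : ScalesBy (Real.exp t : ℂ) k f := by
  intro p hp
  let q : ℝ → Bundle.TotalSpace ℂ E := fun t => fibreSmul (Real.exp t : ℂ) p
  have hexp : ∀ t : ℝ, (Real.exp t : ℂ) ≠ 0 := fun t => by exact_mod_cast (Real.exp_pos t).ne'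
  have hq : ∀ t, q t ∈ puncturedTotal E := fun t => fibreSmul_mem (hexp t) hp
  have hadd : ∀ s t, fibreSmul (Real.exp s : ℂ) (q t) = q (t + s) := by
    intro s t
    simp only [q, fibreSmul_fibreSmul, Real.exp_add, Complex.ofReal_mul, mul_comm]
  obtain ⟨y, hy, hyp⟩ := exists_param_eq (m := m) hp
  have hdiff : Differentiable ℝ fun t => f (q t) := by
    intro t
    have h1 : (fun t => f (q t)) = fun t : ℝ => f (param E p.1 (y.1, (Real.exp t : ℂ) * y.2)) := by
      funext t
      rw [param_mul hy.1, hyp]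
    rw [h1]
    have h2 : DifferentiableAt ℝ (fun y' : EuclideanSpace ℂ (Fin m) × ℂ => f (param E p.1 y'))
        (y.1, (Real.exp t : ℂ) * y.2) :=
      ((hf.1 p.1).contDiffAt ((isOpen_coordDomain E p.1).mem_nhds
        (dilate_mem (hexp t) hy))).differentiableAt (by simp)
    have h3 : DifferentiableAt ℝ (fun t : ℝ => (y.1, (Real.exp t : ℂ) * y.2)) t :=
      (differentiableAt_const _).prodMk
        ((Complex.ofRealCLM.differentiableAt.comp t Real.differentiableAt_exp).mul_const _)
    exact DifferentiableAt.comp (f := fun t : ℝ => (y.1, (Real.exp t : ℂ) * y.2))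
      (g := fun y' => f (param E p.1 y')) t h2 h3
  have hderiv : ∀ t, HasDerivAt (fun t => f (q t)) (k * f (q t)) t := by
    intro t
    have h1 := hf.2 (q t) (hq t)
    have h2 : (fun s : ℝ => f ⟨(q t).1, (Real.exp s : ℂ) • (q t).2⟩) =
        fun s => f (q (t + s)) := by
      funext s
      rw [← hadd]
      rfl
    rw [lieFun, h2] at h1
    have h3 := deriv_comp_const_add (f := fun t => f (q t)) t 0
    rw [h3, add_zero] at h1
    rw [← h1]
    exact (hdiff t).hasDerivAt
  have hconst : ∀ t, Real.exp (-(k : ℝ) * t) * f (q t) = f (q 0) := by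
    intro t
    have hd : ∀ t, HasDerivAt (fun t => Real.exp (-(k : ℝ) * t) * f (q t)) 0 t := by
      intro t
      have h1 : HasDerivAt (fun t : ℝ => -(k : ℝ) * t) (-(k : ℝ)) t := by
        simpa using (hasDerivAt_id t).const_mul (-(k : ℝ))
      exact (h1.exp.mul (hderiv t)).congr_deriv (by ring)
    have := is_const_of_deriv_eq_zero (fun t => (hd t).differentiableAt) (fun t => (hd t).deriv) t 0
    simpa using this
  have h0 : q 0 = p := by simp [q, fibreSmul]
  have := hconst t
  rw [h0] at this
  rw [← this, Complex.norm_real, Real.norm_eq_abs, abs_of_pos (Real.exp_pos t), exp_zpow,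
    ← mul_assoc, ← Real.exp_add]
  simp [q]

end Homogeneous

/-! ### Construction of the potentials by recursion on the weight. -/

section Existence

variable {m : ℕ} {D : Type*} [TopologicalSpace D] [ChartedSpace (EuclideanSpace ℂ (Fin m)) D]
  {E : D → Type*} [∀ x, AddCommGroup (E x)] [∀ x, Module ℂ (E x)]
  [TopologicalSpace (Bundle.TotalSpace ℂ E)] [∀ x, TopologicalSpace (E x)]
  [FiberBundle ℂ E] [VectorBundle ℂ ℂ E] {h : HermitianMetric (m := m) E}
  {u : ℕ → Bundle.TotalSpace ℂ E → ℝ}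

/-- Smooth functions of weight `k`, invariant under rotation of the fibres, and zero for odd `k`. -/
structure IsPotentialFamily (m : ℕ) {D : Type*} [TopologicalSpace D]
    [ChartedSpace (EuclideanSpace ℂ (Fin m)) D]
    {E : D → Type*} [∀ x, AddCommGroup (E x)] [∀ x, Module ℂ (E x)]
    [TopologicalSpace (Bundle.TotalSpace ℂ E)] [∀ x, TopologicalSpace (E x)]
    [FiberBundle ℂ E] (u : ℕ → Bundle.TotalSpace ℂ E → ℝ) : Prop where
  smooth : ∀ k : ℕ, 0 < k → SmoothOff m (u k)
  scales : ∀ c : ℂ, c ≠ 0 → ∀ k : ℕ, 0 < k → ScalesBy c k (u k)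
  odd : ∀ k : ℕ, Odd k → ∀ p ∈ puncturedTotal E, u k p = 0

/-- The coefficient of weight `n` of `log (det ω / det ω₀)` in the coordinates around `x₀`. -/
def HermitianMetric.coeffAt (h : HermitianMetric (m := m) E) (u : ℕ → Bundle.TotalSpace ℂ E → ℝ)
    (n : ℕ) (x₀ : D) (y : EuclideanSpace ℂ (Fin m) × ℂ) : ℂ :=
  logDetCoeff (coordVec m) (h.invNormSq x₀) (fun k y => u k (param E x₀ y)) n y

/-- The potential of weight `n` that the soliton equation determines from those of lower weight. -/
def HermitianMetric.nextPotential (h : HermitianMetric (m := m) E)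
    (u : ℕ → Bundle.TotalSpace ℂ E → ℝ) (n : ℕ) (p : Bundle.TotalSpace ℂ E) : ℝ :=
  2 / (n + 2) * (h.coeffAt u n p.1 (coords E p.1 p)).re

variable [IsManifold 𝓘(ℂ, EuclideanSpace ℂ (Fin m)) ω D]
  [ContMDiffVectorBundle ω ℂ E 𝓘(ℂ, EuclideanSpace ℂ (Fin m))]

/-- The coefficients glue to functions on the complement of the zero section, because transition
maps preserve |S|⁻² and the potentials. -/
theorem HermitianMetric.IsPositive.coeffAt_eq (hpos : h.IsPositive)
    (hu : ∀ k : ℕ, 0 < k → SmoothOff m (u k)) (n : ℕ) {x₀ x₁ : D}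
    {y₀ y₁ : EuclideanSpace ℂ (Fin m) × ℂ} (h₀ : y₀ ∈ coordDomain E x₀)
    (h₁ : y₁ ∈ coordDomain E x₁) (he : param E x₀ y₀ = param E x₁ y₁) :
    h.coeffAt u n x₀ y₀ = h.coeffAt u n x₁ y₁ := by
  obtain ⟨T, rfl, hT, hev⟩ := exists_transition h₀ h₁ he
  have := logDetCoeff_comp (a := 1) (hpos.isAdmissible hu x₁) (hpos.isAdmissible hu x₀)
    eq_sum_coordVec h₀ h₁ hT one_ne_zero
    (hev.mono fun y hy => by simp [HermitianMetric.invNormSq, hy])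
    (fun k _ => hev.mono fun y hy => by simp [hy]) n
  simpa [HermitianMetric.coeffAt] using this

theorem HermitianMetric.IsPositive.nextPotential_param (hpos : h.IsPositive)
    (hu : ∀ k : ℕ, 0 < k → SmoothOff m (u k)) (n : ℕ) {x₀ : D}
    {y : EuclideanSpace ℂ (Fin m) × ℂ} (hy : y ∈ coordDomain E x₀) :
    (h.nextPotential u n (param E x₀ y) : ℂ) = 2 / (n + 2) * h.coeffAt u n x₀ y := by
  set p := param E x₀ y with hp
  have hs := mem_chart_source (EuclideanSpace ℂ (Fin m)) p.1
  have hb := FiberBundle.mem_baseSet_trivializationAt' (F := ℂ) (E := E) p.1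
  have hc : coords E p.1 p ∈ coordDomain (m := m) E p.1 := coords_mem hs hb (param_mem hy)
  have he : h.coeffAt u n p.1 (coords E p.1 p) = h.coeffAt u n x₀ y :=
    hpos.coeffAt_eq hu n hc hy (param_coords hs hb).2
  have hr : ((h.coeffAt u n x₀ y).re : ℂ) = h.coeffAt u n x₀ y :=
    (hpos.isAdmissible hu x₀).logDetCoeff_real n hy
  rw [nextPotential, he]
  push_cast
  rw [hr]

theorem HermitianMetric.IsPositive.smoothOff_nextPotential (hpos : h.IsPositive)
    (hu : ∀ k : ℕ, 0 < k → SmoothOff m (u k)) (n : ℕ) : SmoothOff m (h.nextPotential u n) := by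
  intro x₀ y hy
  refine (contDiffAt_of_ofReal ?_).contDiffWithinAt
  have h1 : ContDiffAt ℝ ∞ (h.coeffAt u n x₀) y :=
    (hpos.isAdmissible hu x₀).contDiffAt_logDetCoeff n hy
  refine (contDiffAt_const (c := (2 / (n + 2) : ℂ)).mul h1).congr_of_eventuallyEq ?_
  filter_upwards [(isOpen_coordDomain E x₀).mem_nhds hy] with y' hy'
  exact hpos.nextPotential_param hu n hy'

theorem HermitianMetric.IsPositive.scalesBy_nextPotential (hpos : h.IsPositive)
    (hu : IsPotentialFamily m u) (n : ℕ) {c : ℂ} (hc : c ≠ 0) :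
    ScalesBy c n (h.nextPotential u n) := by
  intro p hp
  obtain ⟨y, hy, hyp⟩ := exists_param_eq (m := m) hp
  have h1 := hpos.nextPotential_param hu.smooth n hy
  have h2 := hpos.nextPotential_param hu.smooth n (dilate_mem hc hy)
  have h3 : h.coeffAt u n p.1 (dilate m c y) = _ :=
    hpos.logDetCoeff_dilate hu.smooth hc (hu.scales c hc) hy n
  rw [h3, param_dilate c hy, hyp] at h2
  rw [hyp] at h1
  -- The potential is a real multiple of a coefficient of the log-determinant, which scales by the
  -- power `|c| ^ n`.
  apply Complex.ofReal_injective
  push_cast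
  rw [h1, h2, zpow_natCast, coeffAt]
  ring

theorem HermitianMetric.IsPositive.nextPotential_odd (hpos : h.IsPositive)
    (hu : IsPotentialFamily m u) {n : ℕ} (hn : Odd n) {p : Bundle.TotalSpace ℂ E}
    (hp : p ∈ puncturedTotal E) : h.nextPotential u n p = 0 := by
  obtain ⟨y, hy, hyp⟩ := exists_param_eq (m := m) hp
  have h1 := hpos.nextPotential_param hu.smooth n hy
  have h2 : h.coeffAt u n p.1 y = 0 :=
    (hpos.isAdmissible hu.smooth p.1).logDetCoeff_odd
      (fun k hk y hy => hu.odd k hk _ (param_mem hy)) hn hy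
  rw [h2, mul_zero, hyp] at h1
  exact_mod_cast h1

/-- The potentials of weight less than `n`, completed by zero. -/
def HermitianMetric.lowerPotentials (h : HermitianMetric (m := m) E) :
    ℕ → ℕ → Bundle.TotalSpace ℂ E → ℝ
  | 0 => fun _ _ => 0
  | n + 1 => Function.update (h.lowerPotentials n) n (h.nextPotential (h.lowerPotentials n) n)

/-- The potentials `u_(k)` of the formal expanding soliton. -/
def HermitianMetric.potential (h : HermitianMetric (m := m) E) (k : ℕ) :
    Bundle.TotalSpace ℂ E → ℝ :=
  h.nextPotential (h.lowerPotentials k) k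

theorem HermitianMetric.lowerPotentials_of_lt {k n : ℕ} (hk : k < n) :
    h.lowerPotentials n k = h.potential k := by
  induction n with
  | zero => lia
  | succ n ih =>
    rw [lowerPotentials]
    rcases Nat.lt_succ_iff_lt_or_eq.1 hk with hlt | rfl
    · rw [Function.update_of_ne hlt.ne, ih hlt]
    · rw [Function.update_self, potential]

theorem HermitianMetric.IsPositive.isPotentialFamily_lowerPotentials (hpos : h.IsPositive) (n : ℕ) :
    IsPotentialFamily m (h.lowerPotentials n) := by
  induction n with
  | zero => exact ⟨fun _ _ _ => contDiffOn_const,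
      fun _ _ _ _ _ _ => by simp [lowerPotentials], fun _ _ _ _ => rfl⟩
  | succ n ih =>
    refine ⟨fun k hk => ?_, fun c hc k hk => ?_, fun k hk p hp => ?_⟩ <;>
      rw [lowerPotentials] <;> rcases eq_or_ne k n with rfl | hkn
    · rw [Function.update_self]
      exact hpos.smoothOff_nextPotential ih.smooth k
    · rw [Function.update_of_ne hkn]
      exact ih.smooth k hk
    · rw [Function.update_self]
      exact hpos.scalesBy_nextPotential ih k hc
    · rw [Function.update_of_ne hkn]
      exact ih.scales c hc k hk
    · rw [Function.update_self]
      exact hpos.nextPotential_odd ih hk hp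
    · rw [Function.update_of_ne hkn]
      exact ih.odd k hk p hp

theorem HermitianMetric.IsPositive.isPotentialFamily (hpos : h.IsPositive) :
    IsPotentialFamily m h.potential where
  smooth k _ := hpos.smoothOff_nextPotential (hpos.isPotentialFamily_lowerPotentials k).smooth k
  scales _ hc k _ := hpos.scalesBy_nextPotential (hpos.isPotentialFamily_lowerPotentials k) k hc
  odd k hk _ hp := hpos.nextPotential_odd (hpos.isPotentialFamily_lowerPotentials k) hk hp

/-- The truncated family may be replaced by the full one, since only lower potentials enter the
coefficient. -/
theorem HermitianMetric.IsPositive.potential_param (hpos : h.IsPositive) (k : ℕ) {x₀ : D}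
    {y : EuclideanSpace ℂ (Fin m) × ℂ} (hy : y ∈ coordDomain E x₀) :
    (h.potential k (param E x₀ y) : ℂ) = 2 / (k + 2) * h.coeffAt h.potential k x₀ y := by
  have hl := (hpos.isPotentialFamily_lowerPotentials k).smooth
  have h1 : (h.potential k (param E x₀ y) : ℂ) = _ := hpos.nextPotential_param hl k hy
  have h2 : h.coeffAt (h.lowerPotentials k) k x₀ y = h.coeffAt h.potential k x₀ y :=
    (hpos.isAdmissible hl x₀).logDetCoeff_congr (υ' := fun j y => h.potential j (param E x₀ y))
      (fun j _ hj y _ => congrFun (h.lowerPotentials_of_lt hj) _) hy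
  rw [h1, h2]

theorem HermitianMetric.IsPositive.isFormalSoliton_potential (hpos : h.IsPositive) :
    h.IsFormalSoliton h.potential := by
  have hfam := hpos.isPotentialFamily
  have hs : ∀ t : ℝ, ∀ k : ℕ, 0 < k → ScalesBy (Real.exp t : ℂ) k (h.potential k) :=
    fun t => hfam.scales _ (by exact_mod_cast (Real.exp_pos t).ne')
  refine ⟨fun k hk => hasWeight_of_scalesBy (hfam.smooth k hk) fun t => hs t k hk,
    fun x₀ k y hy => ?_⟩
  have hA := hpos.isAdmissible hfam.smooth x₀
  rw [hpos.lieForm_formalForm hfam.smooth hs hy, h.formalForm_eq]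
  by_cases h2 : k = -2
  · subst h2
    simp [formalRicci, smul_smul]
  by_cases h0 : k = 0
  · subst h0
    rw [hA.formalRicci_zero hy]
    simp
  by_cases hk : 0 < k
  · lift k to ℕ using hk.le
    have hk : 0 < k := by exact_mod_cast hk
    have hev : (fun y' => (h.potential k (param E x₀ y') : ℂ)) =ᶠ[nhds y]
        fun y' => (2 / (k + 2) : ℂ) * h.coeffAt h.potential k x₀ y' :=
      ((isOpen_coordDomain E x₀).eventually_mem hy).mono fun y' hy' => hpos.potential_param k hy'
    have hk2 : (k + 2 : ℂ) ≠ 0 := by exact_mod_cast (by lia : k + 2 ≠ 0)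
    rw [hA.formalRicci_pos hk hy, localForm_pos _ _ _ hk, ddbar_congr _ hev, ddbar_const_mul]
    change -ddbar (coordVec m) (h.coeffAt h.potential k x₀) y + _ = _
    ext i j
    simp only [Matrix.add_apply, Matrix.neg_apply, Matrix.smul_apply, smul_eq_mul, Int.cast_natCast]
    field_simp
    ring
  · rw [localForm_eq_zero _ _ _ h2 (by lia)]
    simp [formalRicci, show ¬ 0 ≤ k by lia]

theorem HermitianMetric.IsPositive.isFibrePolynomial_potential (hpos : h.IsPositive) {k : ℕ}
    (hk : 0 < k) : IsFibrePolynomial k (h.potential k) := by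
  have hfam := hpos.isPotentialFamily
  intro p hp
  rcases Nat.even_or_odd k with he | ho
  · obtain ⟨j, rfl⟩ := he
    -- Rotation invariance leaves only the monomial (z z̄)^j = |z|^(2j).
    refine ⟨fun a => if a = j then (h.potential (j + j) p : ℂ) else 0, fun z hz => ?_⟩
    have h1 : h.potential (j + j) ⟨p.1, z • p.2⟩ = ‖z‖ ^ ((j + j : ℕ) : ℤ) * h.potential (j + j) p :=
      hfam.scales z hz _ hk p hp
    rw [Finset.sum_eq_single_of_mem j (by simp) (fun a _ ha => by simp [ha]), h1]
    simp only [if_true]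
    rw [zpow_natCast, Nat.add_sub_cancel, mul_assoc, ← mul_pow, Complex.mul_conj,
      Complex.normSq_eq_norm_sq, pow_add]
    push_cast
    ring
  · refine ⟨fun _ => 0, fun z hz => ?_⟩
    have h1 : h.potential k ⟨p.1, z • p.2⟩ = 0 := hfam.odd k ho _ (fibreSmul_mem hz hp)
    simp [h1]

theorem HermitianMetric.smoothOff_inv_normSq :
    SmoothOff m (fun p : Bundle.TotalSpace ℂ E => (h.normSq p)⁻¹) := fun x₀ _ hy =>
  (contDiffAt_of_ofReal (h.contDiffAt_invNormSq (x₀ := x₀) hy)).contDiffWithinAt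

/-- A function of weight `k` that is invariant under rotation of the fibres, multiplied by `k / 2`,
is a potential for the contraction of its Levi form with `z ∂_z`. -/
theorem mul_levi_of_scalesBy {k : ℤ} {f : Bundle.TotalSpace ℂ E → ℝ} (hf : SmoothOff m f)
    (hs : ∀ c : ℂ, c ≠ 0 → ScalesBy c k f) {x₀ : D} {y : EuclideanSpace ℂ (Fin m) × ℂ}
    (hy : y ∈ coordDomain E x₀) (w : EuclideanSpace ℂ (Fin m) × ℂ) :
    y.2 * levi (fun y' => (f (param E x₀ y') : ℂ)) (0, 1) w y =
      wirtBar (fun y' => ((k / 2 * f (param E x₀ y') : ℝ) : ℂ)) w y := by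
  refine mul_levi_vertical (contDiffAt_two (hf.contDiffAt hy)) ?_ w
  filter_upwards [(isOpen_coordDomain E x₀).mem_nhds hy] with y' hy'
  rw [wirt_vertical_of_pow (k := k) (differentiableAt_of_two (contDiffAt_two (hf.contDiffAt hy')))
    fun c hc => ?_]
  · push_cast
    rfl
  · have := (hs c hc).param_dilate hy'
    rw [dilate] at this
    rw [this]
    push_cast
    rfl

theorem HermitianMetric.IsPositive.isGradient_potential (hpos : h.IsPositive) :
    h.IsGradient h.potential := by
  have hfam := hpos.isPotentialFamily
  have hzero : ∀ k : ℤ, HasWeight m k (fun _ : Bundle.TotalSpace ℂ E => (0 : ℝ)) := fun k =>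
    hasWeight_of_scalesBy (fun _ => contDiffOn_const) fun t p _ => by simp
  have hinv : ∀ c : ℂ, ScalesBy c (-2) fun p : Bundle.TotalSpace ℂ E => (h.normSq p)⁻¹ :=
    fun c p _ => by
      change (h.normSq (fibreSmul c p))⁻¹ = ‖c‖ ^ (-2 : ℤ) * (h.normSq p)⁻¹
      rw [h.normSq_fibreSmul, mul_inv, zpow_neg]
      rfl
  -- Euler's identity gives k/2 times the potential in each weight; weight 0 contributes nothing.
  let F : ℤ → Bundle.TotalSpace ℂ E → ℝ := fun k p =>
    if k = -2 then (k : ℝ) / 2 * (h.normSq p)⁻¹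
    else if 0 < k then (k : ℝ) / 2 * h.potential k.toNat p else 0
  have hmul : ∀ (k : ℤ) (f : Bundle.TotalSpace ℂ E → ℝ), SmoothOff m f →
      (∀ c : ℂ, c ≠ 0 → ScalesBy c k f) → HasWeight m k fun p => (k : ℝ) / 2 * f p :=
    fun k f hf hs => hasWeight_of_scalesBy (fun x₀ => contDiffOn_const.mul (hf x₀)) fun t p hp => by
      rw [hs _ (by exact_mod_cast (Real.exp_pos t).ne') p hp]
      ring
  refine ⟨F, fun k => ?_, fun k hk p _ => ?_, fun x₀ k y hy j => ?_⟩
  · by_cases h2 : k = -2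
    · simp only [F, if_pos h2]
      exact hmul k _ h.smoothOff_inv_normSq fun c _ => h2 ▸ hinv c
    · by_cases hk : 0 < k
      · simp only [F, if_neg h2, if_pos hk]
        lift k to ℕ using hk.le
        have hk : 0 < k := by exact_mod_cast hk
        exact hmul k _ (hfam.smooth k hk) fun c hc => hfam.scales c hc k hk
      · simp only [F, if_neg h2, if_neg hk]
        exact hzero k
  · simp only [F, if_neg hk.ne, if_neg (show ¬ 0 < k by lia)]
  · have hA := hpos.isAdmissible hfam.smooth x₀
    rw [h.formalForm_eq]
    by_cases h2 : k = -2
    · simp only [F, if_pos h2]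
      rw [h2, localForm_neg_two]
      exact mul_levi_of_scalesBy h.smoothOff_inv_normSq (fun c _ => hinv c) hy _
    by_cases hk : 0 < k
    · simp only [F, if_neg h2, if_pos hk]
      lift k to ℕ using hk.le
      have hk : 0 < k := by exact_mod_cast hk
      rw [localForm_pos _ _ _ hk]
      exact mul_levi_of_scalesBy (hfam.smooth k hk) (fun c hc => hfam.scales c hc k hk) hy _
    simp only [F, if_neg h2, if_neg hk, Complex.ofReal_zero, wirtBar_const]
    by_cases h0 : k = 0
    · subst h0
      rw [hA.localForm_zero hy, ddbar_apply]
      -- In weight 0 the potential log det ω₀ is not homogeneous but changes by a multiple of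
      -- log|c|, so z∂_z maps it to a constant, which ∂̄ kills.
      refine (mul_levi_vertical (g := fun _ => (-(2 * m + 4) : ℂ) / 2)
        (contDiffAt_two (hA.contDiffAt_logNormDet hy)) ?_ _).trans (wirtBar_const _ _ _)
      filter_upwards [(isOpen_coordDomain E x₀).mem_nhds hy] with y' hy'
      refine wirt_vertical_of_log
        (differentiableAt_of_two (contDiffAt_two (hA.contDiffAt_logNormDet hy'))) fun c hc => ?_
      have := hpos.logNormDet_dilate hc hy'
      rw [dilate] at this
      rw [this]
      push_cast
      rfl
    · rw [localForm_eq_zero _ _ _ h2 (by lia)]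
      simp

end Existence

/-! ### Uniqueness by a maximum principle on the compact base. -/

section Uniqueness

variable {m : ℕ} {D : Type*} [TopologicalSpace D] [ChartedSpace (EuclideanSpace ℂ (Fin m)) D]
  {E : D → Type*} [∀ x, AddCommGroup (E x)] [∀ x, Module ℂ (E x)]
  [TopologicalSpace (Bundle.TotalSpace ℂ E)] [∀ x, TopologicalSpace (E x)]
  [FiberBundle ℂ E] [VectorBundle ℂ ℂ E] {h : HermitianMetric (m := m) E}
  {u : ℕ → Bundle.TotalSpace ℂ E → ℝ}

/-- A function on the complement of the zero section that is continuous in coordinates and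
invariant under positive dilations attains its maximum. -/
theorem exists_forall_le_of_invariant [CompactSpace D] {q : Bundle.TotalSpace ℂ E → ℝ}
    (hq : ∀ x₀ : D, ContinuousOn (fun y : EuclideanSpace ℂ (Fin m) × ℂ => q (param E x₀ y))
      (coordDomain E x₀))
    (hinv : ∀ r : ℝ, 0 < r → ∀ p ∈ puncturedTotal E, q (fibreSmul r p) = q p)
    (hne : (puncturedTotal E).Nonempty) :
    ∃ p₀ ∈ puncturedTotal E, ∀ p ∈ puncturedTotal E, q p ≤ q p₀ := by
  have hloc : ∀ x : D, ∃ U ∈ nhds x, ∃ p₀ ∈ puncturedTotal E,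
      ∀ p ∈ puncturedTotal E, p.1 ∈ U → q p ≤ q p₀ := by
    intro x
    let c := chartAt (EuclideanSpace ℂ (Fin m)) x
    have hx : x ∈ c.source := mem_chart_source _ x
    have hxd : c x ∈ baseDomain E x := by
      refine ⟨c.map_source hx, ?_⟩
      rw [c.left_inv hx]
      exact FiberBundle.mem_baseSet_trivializationAt' x
    obtain ⟨K, hK, hxK, hKd⟩ := exists_compact_subset (isOpen_baseDomain E x) hxd
    -- Every point over `K` can be dilated to |z| = 1, so a compact set of coordinates suffices.
    have hcompact : IsCompact (K ×ˢ Metric.sphere (0 : ℂ) 1) := hK.prod (isCompact_sphere _ _)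
    have hsub : K ×ˢ Metric.sphere (0 : ℂ) 1 ⊆ coordDomain E x := fun y hy =>
      ⟨hKd hy.1, fun h0 => by simpa [h0] using hy.2⟩
    obtain ⟨y₀, hy₀, hmax⟩ := hcompact.exists_isMaxOn
      ⟨(c x, 1), interior_subset hxK, by simp⟩ ((hq x).mono hsub)
    refine ⟨c.source ∩ c ⁻¹' K, Filter.inter_mem (c.open_source.mem_nhds hx)
      ((c.continuousAt hx).preimage_mem_nhds (mem_interior_iff_mem_nhds.1 hxK)),
      param E x y₀, param_mem (hsub hy₀), fun p hp hpU => ?_⟩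
    have hb : p.1 ∈ (trivializationAt ℂ E x).baseSet := by
      have := (hKd hpU.2).2
      rwa [c.left_inv hpU.1] at this
    have hy := coords_mem hpU.1 hb hp
    have hyp := (param_coords (m := m) hpU.1 hb).2
    set y := coords (m := m) E x p
    have hpos : 0 < ‖y.2‖ := norm_pos_iff.2 hy.2
    rw [← hyp, ← hinv ‖y.2‖⁻¹ (inv_pos.2 hpos) _ (param_mem hy), ← param_mul hy.1]
    refine hmax ⟨hpU.2, ?_⟩
    simp [hpos.ne']
  choose U hU P hP hPU using hloc
  obtain ⟨t, ht⟩ := CompactSpace.elim_nhds_subcover U hU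
  have hcover : ∀ x : D, ∃ x' ∈ t, x ∈ U x' := fun x => by
    have : x ∈ ⋃ x' ∈ t, U x' := by
      rw [ht]
      trivial
    simpa using this
  obtain ⟨p₁, -⟩ := hne
  obtain ⟨x₁, hx₁, -⟩ := hcover p₁.1
  obtain ⟨x₀, -, hmax⟩ := t.exists_max_image (fun x => q (P x)) ⟨x₁, hx₁⟩
  refine ⟨P x₀, hP x₀, fun p hp => ?_⟩
  obtain ⟨x, hx, hpx⟩ := hcover p.1
  exact (hPU x p hp hpx).trans (hmax x hx)

/-- A positive maximum M of f/|S|^k gives the comparison function M|S|^k - f a local minimum. There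
its Levi form would be nonnegative, but f contributes nothing and |S|^k contributes a negative term
in a suitable direction. -/
theorem HermitianMetric.IsPositive.nonpos_of_levi_eq_zero [CompactSpace D] (hm : 1 ≤ m)
    (hpos : h.IsPositive) {k : ℕ} (hk : 0 < k) {f : Bundle.TotalSpace ℂ E → ℝ} (hf : SmoothOff m f)
    (hs : ∀ t : ℝ, ScalesBy (Real.exp t : ℂ) k f)
    (hl : ∀ x₀ : D, ∀ y ∈ coordDomain (m := m) E x₀, ∀ v,
      levi (fun y' => (f (param E x₀ y') : ℂ)) v v y = 0)
    {p : Bundle.TotalSpace ℂ E} (hp : p ∈ puncturedTotal E) : f p ≤ 0 := by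
  by_contra! hfp
  let a : ℝ := k / 2
  have ha : 0 < a := by positivity
  -- This is f/|S|^k: with a = k/2, exp(a log|S|²) = |S|^k.
  let q : Bundle.TotalSpace ℂ E → ℝ := fun p => Real.exp (-(a * Real.log (h.normSq p))) * f p
  obtain ⟨p₀, hp₀, hmax⟩ := exists_forall_le_of_invariant (m := m) (q := q) (fun x₀ y hy => by
      have h1 : ContDiffAt ℝ ∞ (h.logNormSq x₀) y :=
        contDiffAt_of_ofReal (h.contDiffAt_logNormSq hy)
      have h2 : ContDiffAt ℝ ∞ (fun y => f (param E x₀ y)) y :=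
        contDiffAt_of_ofReal (hf.contDiffAt hy)
      exact ((contDiffAt_const.mul h1).neg.exp.mul h2).continuousAt.continuousWithinAt)
    (fun r hr p hp => by
      have h1 := hs (Real.log r) p hp
      rw [Real.exp_log hr, Complex.norm_real, Real.norm_eq_abs, abs_of_pos hr] at h1
      simp only [q]
      rw [h1, h.normSq_fibreSmul, Complex.norm_real, Real.norm_eq_abs, abs_of_pos hr,
        Real.log_mul (by positivity) (h.normSq_pos hp).ne', Real.log_pow, zpow_natCast,
        ← mul_assoc]
      congr 1
      rw [← Real.exp_log (pow_pos hr k), ← Real.exp_add, Real.log_pow]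
      congr 1
      simp only [a]
      push_cast
      ring) ⟨p, hp⟩
  have hM : 0 < q p₀ := lt_of_lt_of_le (mul_pos (Real.exp_pos _) hfp) (hmax p hp)
  obtain ⟨y, hy, hyp⟩ := exists_param_eq (m := m) hp₀
  set x₀ := p₀.1
  let N : EuclideanSpace ℂ (Fin m) × ℂ → ℝ := fun y' =>
    q p₀ * Real.exp (a * h.logNormSq x₀ y') - f (param E x₀ y')
  have hNq : ∀ y', N y' = Real.exp (a * h.logNormSq x₀ y') * (q p₀ - q (param E x₀ y')) := by
    intro y'
    simp only [N, q, HermitianMetric.logNormSq]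
    rw [Real.exp_neg (a * Real.log (h.normSq (param E x₀ y')))]
    field_simp
  have hmin : IsLocalMin N y := by
    filter_upwards [(isOpen_coordDomain E x₀).mem_nhds hy] with y' hy'
    rw [hNq y, hyp, sub_self, mul_zero, hNq]
    exact mul_nonneg (Real.exp_pos _).le (sub_nonneg.2 (hmax _ (param_mem hy')))
  have hφ := contDiffAt_two (h.contDiffAt_logNormSq hy)
  have hf2 := contDiffAt_two (hf.contDiffAt hy)
  have hNc : (fun y' => (N y' : ℂ)) = fun y' =>
      (q p₀ : ℂ) * Complex.exp ((a : ℂ) * (h.logNormSq x₀ y' : ℂ)) - (f (param E x₀ y') : ℂ) := by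
    funext y'
    simp only [N]
    push_cast
    rfl
  have hexp : ContDiffAt ℝ 2 (fun y' => Complex.exp ((a : ℂ) * (h.logNormSq x₀ y' : ℂ))) y :=
    (contDiffAt_const.mul hφ).cexp
  have hNs : ContDiffAt ℝ 2 (fun y' => (N y' : ℂ)) y := by
    rw [hNc]
    exact (contDiffAt_const.mul hexp).sub hf2
  -- A nonzero base direction exists because m ≥ 1.
  let e : EuclideanSpace ℂ (Fin m) := baseVec m ⟨0, hm⟩
  have he : e ≠ 0 := by simp [e, baseVec]
  let b := wirt (fun y' => (h.logNormSq x₀ y' : ℂ)) (0, 1) y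
  have hb : b ≠ 0 := right_ne_zero_of_mul_eq_one (h.wirt_logNormSq_vertical hy)
  -- The lift of `e` is corrected vertically so that ∂ log|S|² vanishes on it. This removes the
  -- nonnegative term ∂φ ∧ ∂̄φ from the Levi form of |S|^k and leaves a positive multiple of ∂∂̄φ,
  -- which is negative on `e`.
  let s := -wirt (fun y' => (h.logNormSq x₀ y' : ℂ)) (e, 0) y / b
  let v : EuclideanSpace ℂ (Fin m) × ℂ := (e, 0) + s • (0, 1)
  have hv : wirt (fun y' => (h.logNormSq x₀ y' : ℂ)) v y = 0 := by
    rw [wirt_add_left, wirt_smul_left]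
    simp only [s]
    field_simp
    ring
  have hv1 : v.1 = e := by simp [v]
  have hneg := hpos.levi_neg hy.1 he
  have hnn := levi_nonneg_of_isLocalMin hNs hmin v
  rw [hNc, levi_sub (contDiffAt_const.mul hexp) hf2, hl x₀ y hy v, levi_const_mul,
    levi_exp (contDiffAt_const.mul hφ), levi_const_mul, wirt_const_mul, hv, h.levi_logNormSq hy,
    hv1, sub_zero, mul_zero, zero_mul, add_zero, ← Complex.ofReal_mul, ← Complex.ofReal_exp,
    Complex.re_ofReal_mul, Complex.re_ofReal_mul, Complex.re_ofReal_mul] at hnn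
  have := mul_neg_of_pos_of_neg hM (mul_neg_of_pos_of_neg (Real.exp_pos (a * h.logNormSq x₀ y))
    (mul_neg_of_pos_of_neg ha hneg))
  linarith

/-- A pluriharmonic function of positive weight vanishes, as a negative line bundle has no nonzero
holomorphic sections. -/
theorem HermitianMetric.IsPositive.eq_zero_of_levi_eq_zero [CompactSpace D] (hm : 1 ≤ m)
    (hpos : h.IsPositive) {k : ℕ} (hk : 0 < k) {f : Bundle.TotalSpace ℂ E → ℝ} (hf : SmoothOff m f)
    (hs : ∀ t : ℝ, ScalesBy (Real.exp t : ℂ) k f)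
    (hl : ∀ x₀ : D, ∀ y ∈ coordDomain (m := m) E x₀, ∀ v,
      levi (fun y' => (f (param E x₀ y') : ℂ)) v v y = 0)
    {p : Bundle.TotalSpace ℂ E} (hp : p ∈ puncturedTotal E) : f p = 0 := by
  refine le_antisymm (hpos.nonpos_of_levi_eq_zero hm hk hf hs hl hp) ?_
  have := hpos.nonpos_of_levi_eq_zero (f := fun p => -f p) hm hk (fun x₀ => (hf x₀).neg)
    (fun t p hp => by simp only [hs t p hp, mul_neg]) (fun x₀ y hy v => by
      have h1 := levi_const_mul (-1) (fun y' => (f (param E x₀ y') : ℂ)) v v y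
      rw [hl x₀ y hy v, mul_zero] at h1
      simpa using h1) hp
  linarith

/-- The equation of weight `k` solved for the form of weight `k`. It fixes the potential only up to
a pluriharmonic function of weight `k`. -/
theorem HermitianMetric.IsFormalSoliton.ddbar_eq (hpos : h.IsPositive) (hu : h.IsFormalSoliton u)
    {k : ℕ} (hk : 0 < k) {x₀ : D} {y : EuclideanSpace ℂ (Fin m) × ℂ} (hy : y ∈ coordDomain E x₀) :
    ddbar (coordVec m) (fun y' => (u k (param E x₀ y') : ℂ)) y =
      (2 / (k + 2) : ℂ) • ddbar (coordVec m) (h.coeffAt u k x₀) y := by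
  have hsm : ∀ k : ℕ, 0 < k → SmoothOff m (u k) := fun k hk => (hu.weight k hk).1
  have hs := hu.soliton x₀ k y hy
  rw [hpos.lieForm_formalForm hsm (fun t k hk => scalesBy_of_hasWeight (hu.weight k hk) t) hy,
    h.formalForm_eq, (hpos.isAdmissible hsm x₀).formalRicci_pos hk hy, localForm_pos _ _ _ hk] at hs
  change -ddbar (coordVec m) (h.coeffAt u k x₀) y + _ = _ at hs
  have hk2 : (k + 2 : ℂ) ≠ 0 := by exact_mod_cast (by lia : k + 2 ≠ 0)
  ext i j
  have hij := congrFun (congrFun hs i) j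
  simp only [Matrix.add_apply, Matrix.neg_apply, Matrix.smul_apply, smul_eq_mul,
    Int.cast_natCast] at hij ⊢
  field_simp
  linear_combination 2 * hij

theorem HermitianMetric.IsFormalSoliton.eqOn [CompactSpace D] (hm : 1 ≤ m) (hpos : h.IsPositive)
    {u' : ℕ → Bundle.TotalSpace ℂ E → ℝ} (hu : h.IsFormalSoliton u) (hu' : h.IsFormalSoliton u')
    {k : ℕ} (hk : 0 < k) : Set.EqOn (u' k) (u k) (puncturedTotal E) := by
  induction k using Nat.strong_induction_on with
  | _ k ih =>
    intro p hp
    have hw := hu.weight k hk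
    have hw' := hu'.weight k hk
    rw [← sub_eq_zero]
    -- Both solutions agree in lower weights, hence have the same coefficient of weight `k`, and
    -- their difference is pluriharmonic.
    refine hpos.eq_zero_of_levi_eq_zero (f := fun p => u' k p - u k p) hm hk
      (fun x₀ => (hw'.1 x₀).sub (hw.1 x₀)) (fun t p hp => ?_) (fun x₀ y hy v => ?_) hp
    · simp only [scalesBy_of_hasWeight hw t p hp, scalesBy_of_hasWeight hw' t p hp, mul_sub]
    · have hA := hpos.isAdmissible (fun k hk => (hu.weight k hk).1) x₀
      have hcoeff : h.coeffAt u k x₀ =ᶠ[nhds y] h.coeffAt u' k x₀ :=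
        ((isOpen_coordDomain E x₀).eventually_mem hy).mono fun y' hy' =>
          hA.logDetCoeff_congr (υ' := fun j y => u' j (param E x₀ y))
            (fun j hj hjk y hy => (ih j hjk hj (param_mem hy)).symm) hy'
      have heq : ddbar (coordVec m) (fun y' => (u' k (param E x₀ y') : ℂ)) y =
          ddbar (coordVec m) (fun y' => (u k (param E x₀ y') : ℂ)) y := by
        rw [hu.ddbar_eq hpos hk hy, hu'.ddbar_eq hpos hk hy, ddbar_congr _ hcoeff]
      have h1 := contDiffAt_two (hw.1.contDiffAt hy)
      have h2 := contDiffAt_two (hw'.1.contDiffAt hy)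
      simp only [Complex.ofReal_sub]
      rw [levi_sub h2 h1, eq_sum_coordVec v, levi_sum h2, levi_sum h1, sub_eq_zero]
      refine Finset.sum_congr rfl fun i _ => Finset.sum_congr rfl fun j _ => ?_
      rw [← ddbar_apply, ← ddbar_apply, heq]

end Uniqueness

end ExpandingSoliton

end

theorem proposition7p26 {m : ℕ} (hm : 1 ≤ m)
    {D : Type*} [TopologicalSpace D] [T2Space D] [CompactSpace D]
    [ChartedSpace (EuclideanSpace ℂ (Fin m)) D]
    [IsManifold 𝓘(ℂ, EuclideanSpace ℂ (Fin m)) ω D]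
    {E : D → Type*} [∀ x, AddCommGroup (E x)] [∀ x, Module ℂ (E x)]
    [TopologicalSpace (Bundle.TotalSpace ℂ E)] [∀ x, TopologicalSpace (E x)]
    [FiberBundle ℂ E] [VectorBundle ℂ ℂ E]
    [ContMDiffVectorBundle ω ℂ E 𝓘(ℂ, EuclideanSpace ℂ (Fin m))]
    (h : ExpandingSoliton.HermitianMetric (m := m) E) (hpos : h.IsPositive) :
    ∃ u : ℕ → Bundle.TotalSpace ℂ E → ℝ,
      h.IsFormalSoliton u ∧
      (∀ u' : ℕ → Bundle.TotalSpace ℂ E → ℝ, h.IsFormalSoliton u' →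
        ∀ k : ℕ, 0 < k → Set.EqOn (u' k) (u k) (ExpandingSoliton.puncturedTotal E)) ∧
      (∀ k : ℕ, 0 < k → ExpandingSoliton.IsFibrePolynomial k (u k)) ∧
      h.IsGradient u :=
  ⟨h.potential, hpos.isFormalSoliton_potential,
    fun _ hu' _ hk => hpos.isFormalSoliton_potential.eqOn hm hpos hu' hk,
    fun _ hk => hpos.isFibrePolynomial_potential hk, hpos.isGradient_potential⟩
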